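/- Every finite simple undirected graph $G$ of maximum degree at most $3$ has a $3$-box representation in which any two boxes can intersect only at their boundaries. That is, one can assign to each vertex $v$ of $G$ an axis-parallel box $B_v=[a_1,b_1]\times[a_2,b_2]\times[a_3,b_3]\subset\mathbb{R}^3$ with $a_i<b_i$ for $i=1,2,3$ (the $a_i,b_i$ depending on $v$), such that for all distinct vertices $v,w$: (i) $v$ and $w$ are adjacent in $G$ if and only if $B_v\cap B_w\neq\emptyset$; and (ii) $B_v\cap B_w\subseteq\partial B_v\cap\partial B_w$. In particular, the boxicity of $G$ is at most $3$, where the boxicity of $G$ is the least integer $k\ge 0$ such that $G$ is the intersection graph of a family of $k$-boxes, i.e. of products of $k$ closed intervals $[a_1,b_1]\times\cdots\times[a_k,b_k]$ (with $a_i\le b_i$) in $\mathbb{R}^k$, indexed by the vertices. -/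

import Mathlib

/-- A `k`-box: a Cartesian product of `k` (nonempty) closed intervals
`[a₁, b₁] × ⋯ × [aₖ, bₖ]` in `ℝᵏ`. Intervals may be single points.
(The product topology on `Fin k → ℝ` is the Euclidean topology.) -/
def IsBox {k : ℕ} (S : Set (Fin k → ℝ)) : Prop :=
  ∃ a b : Fin k → ℝ, (∀ i, a i ≤ b i) ∧ S = Set.pi Set.univ (fun i => Set.Icc (a i) (b i))

/-- The family of sets `B`, indexed by the vertices of `G`, is a `k`-box representation of `G`:
every member is a `k`-box, and `G` is the intersection graph of the family. -/
def IsBoxRepresentation {V : Type*} (G : SimpleGraph V) {k : ℕ}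
    (B : V → Set (Fin k → ℝ)) : Prop :=
  (∀ v, IsBox (B v)) ∧ ∀ v w, G.Adj v w ↔ v ≠ w ∧ (B v ∩ B w).Nonempty

/-- `G` has a `k`-box representation. -/
def HasBoxRepresentation {V : Type*} (G : SimpleGraph V) (k : ℕ) : Prop :=
  ∃ B : V → Set (Fin k → ℝ), IsBoxRepresentation G B

/-- The boxicity of `G`: the least `k` such that `G` has a `k`-box representation
(`⊤` if there is no such `k`). -/
noncomputable def boxicity {V : Type*} (G : SimpleGraph V) : ℕ∞ :=
  ⨅ (k : ℕ) (_ : HasBoxRepresentation G k), (k : ℕ∞)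

/-! Choose a vertex set `C` of induced degree at most two, of maximum size and then with the most
induced edges. By `exists_saturated_set`, every vertex outside `C` has a neighbour in `C` that
already has two neighbours in `C`. Call the vertices of `C` thin and the others thick. One edge at
each thick vertex is thus spent on a thin vertex with no other thick neighbour, and at most two
edges per thick vertex remain to be controlled.

In the last two coordinates a thick vertex `a` is an upper-right box with corner `(q a, N - q a)`,
reflected through the origin if its colour is `false`. Corners of one colour lie on an antidiagonal.
Each box reaches just to its farthest thick neighbours, so the intersections of thick boxes are
correct if no two thick edges cross in the order `q` in the pattern forbidden by
`ThickOrder.noncross`. A thin box usually surrounds the origin and reaches just to the corners of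
its thick neighbours. The only corners it can hit wrongly belong to thick vertices strictly between
two equally coloured neighbours. These are separated in the first coordinate, where a thick box
starts at the smallest right end among its thin neighbours and extends beyond all thin boxes. This
needs the order and the colouring to satisfy `ThickOrder.between`.

The colouring comes from a hypergraph: nodes are components of the thick graph, hyperedges are thin
vertices with several thick neighbours. Counting edges (`no_three_slots`) shows that nodes have
degree at most two, so all hyperedges but one root per component can be made bichromatic. Joining
thick vertices that are adjacent or linked by a thin vertex in one colour then gives a graph of
degree at most two. It is laid out on a line, each cycle being broken at a pair of least weight, so
that a bad vertex inside a broken link sees only later thin vertices.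

Among themselves, thin vertices form paths and cycles. Paths become chains of touching intervals in
the first coordinate; in a cycle one stretched vertex spans the others and is separated from its
non-neighbours in the second or third coordinate. -/

/-! ### Linear layouts of forests of paths -/

/-- Along a walk, an integer-valued labelling with unit steps takes all intermediate values. -/
theorem exists_adj_of_label_between {V : Type*} {F : SimpleGraph V} {p : V → ℤ}
    (hadj : ∀ u v, F.Adj u v → |p u - p v| = 1) {u w : V} (h : F.Reachable u w) {k : ℤ}
    (hu : p u ≤ k) (hw : k < p w) :
    ∃ a b, F.Reachable u a ∧ F.Adj a b ∧ p a = k ∧ p b = k + 1 := by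
  obtain ⟨q⟩ := h
  induction q with
  | nil => omega
  | @cons u x w h q ih =>
    by_cases hx : p x ≤ k
    · obtain ⟨a, b, ha, hab, h1, h2⟩ := ih hx hw
      exact ⟨a, b, h.reachable.trans ha, hab, h1, h2⟩
    · have := hadj u x h
      rcases abs_eq (by norm_num : (0:ℤ) ≤ 1) |>.1 this with h' | h'
      · omega
      · exact ⟨u, x, SimpleGraph.Reachable.refl _, h, by omega, by omega⟩

theorem exists_adj_label_succ {V : Type*} {F : SimpleGraph V} {p : V → ℤ}
    (hinj : Function.Injective p)
    (hadj : ∀ u v, F.Adj u v → |p u - p v| = 1) {u w : V} (h : F.Reachable u w)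
    (hw : p u < p w) : ∃ z, F.Adj u z ∧ p z = p u + 1 := by
  obtain ⟨a, b, -, hab, h1, h2⟩ := exists_adj_of_label_between hadj h le_rfl hw
  exact ⟨b, hinj h1 ▸ hab, h2⟩

theorem exists_adj_label_pred {V : Type*} {F : SimpleGraph V} {p : V → ℤ}
    (hinj : Function.Injective p)
    (hadj : ∀ u v, F.Adj u v → |p u - p v| = 1) {u w : V} (h : F.Reachable u w)
    (hw : p w < p u) : ∃ z, F.Adj u z ∧ p z = p u - 1 := by
  obtain ⟨z, h1, h2⟩ := exists_adj_label_succ (F := F) (p := fun v => - p v)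
    (fun a b h => hinj (neg_injective h))
    (fun u v h => by rw [← hadj u v h, ← abs_neg]; congr 1; ring) h (by simpa using hw)
  exact ⟨z, h1, by omega⟩

theorem reachable_of_label_between {V : Type*} {F : SimpleGraph V} {p : V → ℤ}
    (hinj : Function.Injective p)
    (hadj : ∀ u v, F.Adj u v → |p u - p v| = 1) {u v z : V} (h : F.Reachable u v)
    (hz : p u < p z ∧ p z < p v ∨ p v < p z ∧ p z < p u) : F.Reachable u z := by
  rcases hz with ⟨h1, h2⟩ | ⟨h1, h2⟩
  · obtain ⟨a, b, ha, -, h3, -⟩ := exists_adj_of_label_between hadj h h1.le h2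
    exact hinj h3 ▸ ha
  · obtain ⟨a, b, ha, -, h3, -⟩ := exists_adj_of_label_between hadj h.symm h1.le h2
    exact hinj h3 ▸ (h.trans ha)

/-- In a layout of a linear forest, a vertex with at most one neighbour is an end of its part. -/
theorem label_one_sided {V : Type*} {F : SimpleGraph V} {p : V → ℤ}
    (hinj : Function.Injective p)
    (hadj : ∀ u v, F.Adj u v → |p u - p v| = 1) {u : V}
    (hu : ∀ a b, F.Adj u a → F.Adj u b → a = b) :
    (∀ w, F.Reachable u w → p u ≤ p w) ∨ (∀ w, F.Reachable u w → p w ≤ p u) := by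
  by_contra! hcon
  obtain ⟨⟨w, hw, hw'⟩, ⟨x, hx, hx'⟩⟩ := hcon
  obtain ⟨z, hz, hz'⟩ := exists_adj_label_pred hinj hadj hw hw'
  obtain ⟨y, hy, hy'⟩ := exists_adj_label_succ hinj hadj hx hx'
  have := hu z y hz hy
  subst this
  omega

/-- A finite acyclic graph of maximum degree at most two can be laid out on the integers so that
adjacency means being at distance one. -/
theorem exists_linear_layout {V : Type*} [Finite V] (F : SimpleGraph V) (hac : F.IsAcyclic)
    (hdeg : ∀ u a b c, F.Adj u a → F.Adj u b → F.Adj u c → a = b ∨ a = c ∨ b = c) :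
    ∃ p : V → ℤ, Function.Injective p ∧ ∀ u v, F.Adj u v ↔ |p u - p v| = 1 := by
  classical
  cases nonempty_fintype V
  induction hn : F.edgeSet.ncard using Nat.strong_induction_on generalizing F with
  | _ n ih =>
  by_cases hF : ∃ u v, F.Adj u v
  swap
  · push Not at hF
    refine ⟨fun v => 2 * (Fintype.equivFin V v : ℕ), fun a b h => ?_, fun u v => ?_⟩
    · apply (Fintype.equivFin V).injective
      ext
      simp only at h
      omega
    · simp only [hF, false_iff]
      intro h
      rcases abs_eq (by norm_num : (0:ℤ) ≤ 1) |>.1 h with h' | h' <;> omega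
  obtain ⟨u, v, huv⟩ := hF
  set F' := F.deleteEdges {s(u, v)} with hF'
  have hle : F' ≤ F := SimpleGraph.deleteEdges_le _
  have hadj' : ∀ a b, F'.Adj a b ↔ F.Adj a b ∧ ¬ (a = u ∧ b = v ∨ a = v ∧ b = u) := by
    intro a b
    simp [hF', SimpleGraph.deleteEdges_adj]
  have hlt : F'.edgeSet.ncard < n := by
    rw [← hn]
    apply Set.ncard_lt_ncard _ (Set.toFinite _)
    rw [SimpleGraph.edgeSet_ssubset_edgeSet]
    refine lt_of_le_of_ne hle (fun h => ?_)
    have := (hadj' u v).1 (h ▸ huv)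
    tauto
  -- The edge `u v` is a bridge, so after its deletion `u` and `v` are ends of two different paths,
  -- which can be laid out one after the other.
  have hbr : ¬ F'.Reachable u v := by
    have := SimpleGraph.isAcyclic_iff_forall_adj_isBridge.1 hac huv
    rw [SimpleGraph.isBridge_iff] at this
    exact this
  obtain ⟨p, hinj, hp⟩ := ih _ hlt F' (hac.anti hle)
    (fun x a b c ha hb hc => hdeg x a b c (hle ha) (hle hb) (hle hc)) rfl
  have hpa := fun a b h => (hp a b).1 h
  have hu1 : ∀ a b, F'.Adj u a → F'.Adj u b → a = b := by
    intro a b ha hb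
    have h1 := (hadj' u a).1 ha
    have h2 := (hadj' u b).1 hb
    rcases hdeg u a b v h1.1 h2.1 huv with h | h | h <;> grind
  have hv1 : ∀ a b, F'.Adj v a → F'.Adj v b → a = b := by
    intro a b ha hb
    have h1 := (hadj' v a).1 ha
    have h2 := (hadj' v b).1 hb
    rcases hdeg v a b u h1.1 h2.1 huv.symm with h | h | h <;> grind
  have hsu := label_one_sided hinj hpa hu1
  have hsv := label_one_sided hinj hpa hv1
  set M : ℤ := 10 * ∑ x, |p x| + 10 with hM
  have hMb : ∀ x, |p x| * 10 + 10 ≤ M := by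
    intro x
    have := Finset.single_le_sum (f := fun x => |p x|) (fun i _ => abs_nonneg _) (Finset.mem_univ x)
    omega
  have hMb' : ∀ x, p x * 10 + 10 ≤ M ∧ -p x * 10 + 10 ≤ M := by
    intro x
    have h1 := hMb x
    have h2 := le_abs_self (p x)
    have h3 := neg_le_abs (p x)
    constructor <;> linarith
  -- As `u` and `v` are ends of their parts, each absolute value is a translation or a reflection:
  -- the part of `u` ends at `0` with `u`, that of `v` starts at `1` with `v`, and `M` pushes the
  -- rest beyond both.
  set p' : V → ℤ := fun w => if F'.Reachable u w then - |p w - p u| else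
    if F'.Reachable v w then 1 + |p w - p v| else p w + M with hp'
  have hku : ∃ e : ℤ, (e = 1 ∨ e = -1) ∧ ∀ a, F'.Reachable u a →
      p' a = e * (p a - p u) ∧ e * (p a - p u) ≤ 0 := by
    rcases hsu with h | h
    · refine ⟨-1, Or.inr rfl, fun a ha => ?_⟩
      simp only [hp', ha, if_true, abs_of_nonneg (sub_nonneg.2 (h a ha))]
      have := h a ha
      constructor <;> linarith
    · refine ⟨1, Or.inl rfl, fun a ha => ?_⟩
      simp only [hp', ha, if_true, abs_of_nonpos (sub_nonpos.2 (h a ha))]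
      have := h a ha
      constructor <;> linarith
  have hkv : ∃ e : ℤ, (e = 1 ∨ e = -1) ∧ ∀ a, F'.Reachable v a → ¬ F'.Reachable u a →
      p' a = 1 + e * (p a - p v) ∧ 0 ≤ e * (p a - p v) := by
    rcases hsv with h | h
    · refine ⟨1, Or.inl rfl, fun a ha hua => ?_⟩
      simp only [hp', ha, hua, if_true, if_false, abs_of_nonneg (sub_nonneg.2 (h a ha))]
      have := h a ha
      constructor <;> linarith
    · refine ⟨-1, Or.inr rfl, fun a ha hua => ?_⟩
      simp only [hp', ha, hua, if_true, if_false, abs_of_nonpos (sub_nonpos.2 (h a ha))]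
      have := h a ha
      constructor <;> linarith
  have hko : ∀ a, ¬ F'.Reachable u a → ¬ F'.Reachable v a → p' a = p a + M := by
    intro a h1 h2
    simp [hp', h1, h2]
  have hnon : ∀ x a b, F'.Reachable x a → ¬ F'.Reachable x b → ¬ F'.Adj a b :=
    fun x a b ha hb h => hb (ha.trans h.reachable)
  obtain ⟨e, he, hku⟩ := hku
  obtain ⟨f, hf, hkv⟩ := hkv
  have hcase : ∀ a, F'.Reachable u a ∨ (F'.Reachable v a ∧ ¬ F'.Reachable u a) ∨
      (¬ F'.Reachable u a ∧ ¬ F'.Reachable v a) := by intro a; tauto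
  have hiff : ∀ x y : ℤ, |x - y| = 1 ↔ x = y + 1 ∨ y = x + 1 := by
    intro x y
    rw [abs_eq (by norm_num)]
    constructor <;> rintro (h | h) <;> first | (left; omega) | (right; omega)
  have heq : ∀ a b, p a = p b → a = b := fun a b h => hinj h
  have huu := SimpleGraph.Reachable.refl (G := F') u
  have hvv := SimpleGraph.Reachable.refl (G := F') v
  have hloc : ∀ a b, F.Adj a b ↔ (F'.Adj a b ∨ (a = u ∧ b = v ∨ a = v ∧ b = u)) := by
    intro a b
    rw [hadj']
    have := huv.symm
    constructor
    · tauto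
    · rintro (h | ⟨rfl, rfl⟩ | ⟨rfl, rfl⟩) <;> tauto
  clear_value p' M
  clear hM hMb hp' ih hadj'
  refine ⟨p', fun a b hab => ?_, fun a b => ?_⟩
  · have ha := hMb' a
    have hb := hMb' b
    have hu := hMb' u
    have hv := hMb' v
    apply heq
    rcases hcase a with h1 | ⟨h1, h1'⟩ | ⟨h1, h1'⟩ <;>
    rcases hcase b with h2 | ⟨h2, h2'⟩ | ⟨h2, h2'⟩
    · have h3 := hku a h1
      have h4 := hku b h2
      rcases he with rfl | rfl <;> omega
    · have h3 := hku a h1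
      have h4 := hkv b h2 h2'
      omega
    · have h3 := hku a h1
      have h4 := hko b h2 h2'
      omega
    · have h3 := hku b h2
      have h4 := hkv a h1 h1'
      omega
    · have h3 := hkv a h1 h1'
      have h4 := hkv b h2 h2'
      rcases hf with rfl | rfl <;> omega
    · have h3 := hkv a h1 h1'
      have h4 := hko b h2 h2'
      rcases hf with rfl | rfl <;> omega
    · have h3 := hku b h2
      have h4 := hko a h1 h1'
      omega
    · have h3 := hkv b h2 h2'
      have h4 := hko a h1 h1'
      rcases hf with rfl | rfl <;> omega
    · have h3 := hko a h1 h1'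
      have h4 := hko b h2 h2'
      omega
  · have ha := hMb' a
    have hb := hMb' b
    have hu := hMb' u
    have hv := hMb' v
    have hne : ∀ x, ¬ F'.Reachable u x → ¬ F'.Reachable v x → x ≠ u ∧ x ≠ v :=
      fun x h1 h2 => ⟨by rintro rfl; exact h1 huu, by rintro rfl; exact h2 hvv⟩
    rw [hloc, hiff]
    rcases hcase a with h1 | ⟨h1, h1'⟩ | ⟨h1, h1'⟩ <;>
    rcases hcase b with h2 | ⟨h2, h2'⟩ | ⟨h2, h2'⟩
    · have : ¬ (a = u ∧ b = v ∨ a = v ∧ b = u) := by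
        rintro (⟨rfl, rfl⟩ | ⟨rfl, rfl⟩) <;> contradiction
      rw [or_iff_left this, hp, hiff, (hku a h1).1, (hku b h2).1]
      rcases he with rfl | rfl <;> omega
    · have h3 := hku a h1
      have h4 := hkv b h2 h2'
      rw [or_iff_right (hnon u a b h1 h2')]
      constructor
      · rintro (⟨rfl, rfl⟩ | ⟨rfl, rfl⟩)
        · rw [sub_self, mul_zero] at h3 h4
          omega
        · contradiction
      · intro h
        left
        exact ⟨heq _ _ (by rcases he with rfl | rfl <;> omega),
          heq _ _ (by rcases hf with rfl | rfl <;> omega)⟩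
    · have h3 := hku a h1
      have h4 := hko b h2 h2'
      have h5 := hne b h2 h2'
      rw [or_iff_right (hnon u a b h1 h2)]
      constructor
      · rintro (⟨rfl, rfl⟩ | ⟨rfl, rfl⟩) <;> simp at h5
      · intro h
        omega
    · have h3 := hku b h2
      have h4 := hkv a h1 h1'
      rw [or_iff_right (fun h => hnon u b a h2 h1' (SimpleGraph.Adj.symm h))]
      constructor
      · rintro (⟨rfl, rfl⟩ | ⟨rfl, rfl⟩)
        · contradiction
        · rw [sub_self, mul_zero] at h3 h4
          omega
      · intro h
        right
        exact ⟨heq _ _ (by rcases hf with rfl | rfl <;> omega),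
          heq _ _ (by rcases he with rfl | rfl <;> omega)⟩
    · have : ¬ (a = u ∧ b = v ∨ a = v ∧ b = u) := by
        rintro (⟨rfl, rfl⟩ | ⟨rfl, rfl⟩) <;> contradiction
      rw [or_iff_left this, hp, hiff, (hkv a h1 h1').1, (hkv b h2 h2').1]
      rcases hf with rfl | rfl <;> omega
    · have h3 := hkv a h1 h1'
      have h4 := hko b h2 h2'
      have h5 := hne b h2 h2'
      rw [or_iff_right (hnon v a b h1 h2')]
      constructor
      · rintro (⟨rfl, rfl⟩ | ⟨rfl, rfl⟩) <;> simp at h5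
      · intro h
        rcases hf with rfl | rfl <;> omega
    · have h3 := hku b h2
      have h4 := hko a h1 h1'
      have h5 := hne a h1 h1'
      rw [or_iff_right (fun h => hnon u b a h2 h1 (SimpleGraph.Adj.symm h))]
      constructor
      · rintro (⟨rfl, rfl⟩ | ⟨rfl, rfl⟩) <;> simp at h5
      · intro h
        omega
    · have h3 := hkv b h2 h2'
      have h4 := hko a h1 h1'
      have h5 := hne a h1 h1'
      rw [or_iff_right (fun h => hnon v b a h2 h1' (SimpleGraph.Adj.symm h))]
      constructor
      · rintro (⟨rfl, rfl⟩ | ⟨rfl, rfl⟩) <;> simp at h5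
      · intro h
        rcases hf with rfl | rfl <;> omega
    · have h5 := hne a h1 h1'
      have : ¬ (a = u ∧ b = v ∨ a = v ∧ b = u) := by
        rintro (⟨rfl, rfl⟩ | ⟨rfl, rfl⟩) <;> simp at h5
      rw [or_iff_left this, hp, hiff, hko a h1 h1', hko b h2 h2']
      omega

/-! ### Layouts with one broken edge per cycle -/

/-- A cycle of a graph of maximum degree two meets no edge outside the cycle. -/
theorem adj_of_reachable_cycle {V : Type*} {F F' : SimpleGraph V} (hle : F' ≤ F)
    (hdeg : ∀ u a b c, F.Adj u a → F.Adj u b → F.Adj u c → a = b ∨ a = c ∨ b = c)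
    {x : V} {c : F'.Walk x x} (hc : c.IsCycle) {y : V} (hy : F.Reachable x y) :
    (∃ a b, a ≠ b ∧ F'.Adj y a ∧ F'.Adj y b) ∧ ∀ z, F.Adj y z → F'.Adj y z := by
  have h2 : ∀ y ∈ c.support, ∃ a b, a ≠ b ∧ F'.Adj y a ∧ F'.Adj y b ∧ a ∈ c.support ∧
      b ∈ c.support := by
    intro y hy
    obtain ⟨a, b, hab, hs⟩ := Set.ncard_eq_two.1 (hc.ncard_neighborSet_toSubgraph_eq_two hy)
    have ha : c.toSubgraph.Adj y a := by
      have : a ∈ c.toSubgraph.neighborSet y := by simp [hs]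
      exact this
    have hb : c.toSubgraph.Adj y b := by
      have : b ∈ c.toSubgraph.neighborSet y := by simp [hs]
      exact this
    exact ⟨a, b, hab, ha.adj_sub, hb.adj_sub, c.mem_verts_toSubgraph.1 ha.snd_mem,
      c.mem_verts_toSubgraph.1 hb.snd_mem⟩
  have h3 : ∀ y ∈ c.support, ∀ z, F.Adj y z → F'.Adj y z ∧ z ∈ c.support := by
    intro y hy z hz
    obtain ⟨a, b, hab, ha, hb, ha', hb'⟩ := h2 y hy
    rcases hdeg y a b z (hle ha) (hle hb) hz with h | rfl | rfl
    · exact absurd h hab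
    · exact ⟨ha, ha'⟩
    · exact ⟨hb, hb'⟩
  have hmem : y ∈ c.support := by
    obtain ⟨q⟩ := hy
    have : ∀ u v (q : F.Walk u v), u ∈ c.support → v ∈ c.support := by
      intro u v q
      induction q with
      | nil => exact id
      | cons h q ih => exact fun hu => ih (h3 _ hu _ h).2
    exact this _ _ q c.start_mem_support
  obtain ⟨a, b, hab, ha, hb, -⟩ := h2 y hmem
  exact ⟨⟨a, b, hab, ha, hb⟩, fun z hz => (h3 y hmem z hz).1⟩

/-- A linear layout of a graph of maximum degree two in which one edge `u v` of each cycle is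
broken; the broken edge and its orientation minimize a given priority `w`. -/
structure BrokenLayout {V : Type*} (F : SimpleGraph V) (w : V → V → ℕ) where
  p : V → ℤ
  Brk : V → V → Prop
  inj : Function.Injective p
  adj_of_near : ∀ u v, |p u - p v| = 1 → F.Adj u v
  near_or_brk : ∀ u v, F.Adj u v → |p u - p v| = 1 ∨ Brk u v ∨ Brk v u
  brk_adj : ∀ u v, Brk u v → F.Adj u v
  brk_not_near : ∀ u v, Brk u v → |p u - p v| ≠ 1
  brk_two : ∀ u v, Brk u v → ∀ z, F.Reachable u z → ∃ x y, x ≠ y ∧ F.Adj z x ∧ F.Adj z y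
  brk_min : ∀ u v, Brk u v → ∀ a b, F.Reachable u a → F.Adj a b → w u v ≤ w a b
  brk_between : ∀ u v, Brk u v → ∀ z, (p u < p z ∧ p z < p v ∨ p v < p z ∧ p z < p u) →
    F.Reachable u z
  brk_unique : ∀ u v u' v', Brk u v → Brk u' v' → F.Reachable u u' → u = u' ∧ v = v'

/-- Remove an edge of least weight from every component in which all vertices have two neighbours. A
cycle that survived would fill its whole component by `adj_of_reachable_cycle`, hence contain the
removed edge; so a linear forest remains. -/
theorem exists_brokenLayout {V : Type*} [Finite V] (F : SimpleGraph V) (w : V → V → ℕ)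
    (hdeg : ∀ u a b c, F.Adj u a → F.Adj u b → F.Adj u c → a = b ∨ a = c ∨ b = c) :
    Nonempty (BrokenLayout F w) := by
  classical
  cases nonempty_fintype V
  let Two : V → Prop := fun u => ∀ z, F.Reachable u z → ∃ x y, x ≠ y ∧ F.Adj z x ∧ F.Adj z y
  have hch : ∀ c : F.ConnectedComponent, ∃ e : V × V, ∀ x, F.connectedComponentMk x = c → Two x →
      F.Reachable x e.1 ∧ F.Adj e.1 e.2 ∧ ∀ a b, F.Reachable e.1 a → F.Adj a b →
        w e.1 e.2 ≤ w a b := by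
    intro c
    induction c using SimpleGraph.ConnectedComponent.ind with
    | _ x =>
    by_cases hx : Two x
    swap
    · refine ⟨(x, x), fun y hy hy' => absurd (fun z hz => hy' z ?_) hx⟩
      exact (SimpleGraph.ConnectedComponent.exact hy).trans hz
    obtain ⟨a, -, -, ha, -⟩ := hx x (SimpleGraph.Reachable.refl _)
    obtain ⟨⟨u, v⟩, huv, hmin⟩ := Finset.exists_min_image
      (Finset.univ.filter (fun e : V × V => F.Reachable x e.1 ∧ F.Adj e.1 e.2))
      (fun e => w e.1 e.2) ⟨(x, a), by simp [ha]⟩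
    simp only [Finset.mem_filter, Finset.mem_univ, true_and] at huv hmin
    refine ⟨(u, v), fun y hy _ => ⟨?_, huv.2, fun a b ha hb => ?_⟩⟩
    · exact (SimpleGraph.ConnectedComponent.exact hy).trans huv.1
    · exact hmin (a, b) ⟨huv.1.trans ha, hb⟩
  choose e he using hch
  let Brk : V → V → Prop := fun u v => Two u ∧ (u, v) = e (F.connectedComponentMk u)
  have hB : ∀ u v, Brk u v → F.Adj u v ∧ ∀ a b, F.Reachable u a → F.Adj a b → w u v ≤ w a b := by
    rintro u v ⟨h1, h2⟩
    have := he _ u rfl h1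
    rw [← h2] at this
    exact this.2
  have hU : ∀ u v u' v', Brk u v → Brk u' v' → F.Reachable u u' → u = u' ∧ v = v' := by
    rintro u v u' v' ⟨-, h1⟩ ⟨-, h2⟩ h
    rw [← SimpleGraph.ConnectedComponent.sound h, ← h1] at h2
    simpa using h2.symm
  let F' : SimpleGraph V := SimpleGraph.mk (fun u v => F.Adj u v ∧ ¬ Brk u v ∧ ¬ Brk v u)
    ⟨fun u v h => ⟨h.1.symm, h.2.2, h.2.1⟩⟩ ⟨fun u h => h.1.ne rfl⟩
  have hle : F' ≤ F := fun u v h => h.1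
  have hac : F'.IsAcyclic := by
    intro x c hc
    have hk := fun y hy => adj_of_reachable_cycle hle hdeg hc (y := y) hy
    have hT : Two x := by
      intro z hz
      obtain ⟨a, b, hab, ha, hb⟩ := (hk z hz).1
      exact ⟨a, b, hab, ha.1, hb.1⟩
    obtain ⟨h1, h2, -⟩ := he _ x rfl hT
    have h3 := (hk _ h1).2 _ h2
    refine h3.2.1 ⟨fun z hz => hT z (h1.trans hz), ?_⟩
    rw [← SimpleGraph.ConnectedComponent.sound h1]
  obtain ⟨p, hinj, hp⟩ := exists_linear_layout F' hac
    (fun x a b c ha hb hc => hdeg x a b c ha.1 hb.1 hc.1)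
  -- The two ends of a broken edge stay connected. The vertex `m` of largest label in the part of
  -- `u` has two neighbours in `F` but only one in `F'`, so it is an end of a removed edge; it
  -- differs from `u`, hence is `v`.
  have hend : ∀ (p : V → ℤ), Function.Injective p → (∀ u v, F'.Adj u v → |p u - p v| = 1) →
      ∀ u v y, Brk u v → F'.Adj u y → p y = p u + 1 → F'.Reachable u v := by
    intro p hinj hadj u v y hb hy hpy
    obtain ⟨m, hm, hmax⟩ := Finset.exists_max_image
      (Finset.univ.filter (fun z => F'.Reachable u z)) p ⟨u, by simp⟩
    simp only [Finset.mem_filter, Finset.mem_univ, true_and] at hm hmax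
    have hmF : F.Reachable u m := hm.mono hle
    obtain ⟨a, b, hab, ha, hb'⟩ := hb.1 m hmF
    have hone : ∀ z, F'.Adj m z → p z = p m - 1 := by
      intro z hz
      have h1 := hmax z (hm.trans hz.reachable)
      have h2 := hadj m z hz
      rcases abs_eq (by norm_num : (0:ℤ) ≤ 1) |>.1 h2 with h | h <;> omega
    have hex : ∃ z, F.Adj m z ∧ ¬ F'.Adj m z := by
      by_contra! hcon
      exact hab (hinj ((hone a (hcon a ha)).trans (hone b (hcon b hb')).symm))
    obtain ⟨z, hz, hz'⟩ := hex
    have hmu : m ≠ u := by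
      rintro rfl
      have := hmax y hy.reachable
      omega
    have : Brk m z ∨ Brk z m := by
      by_contra! hcon
      exact hz' ⟨hz, hcon.1, hcon.2⟩
    rcases this with h | h
    · exact absurd (hU _ _ _ _ hb h hmF).1.symm hmu
    · rw [(hU _ _ _ _ hb h (hmF.trans hz.reachable)).2]
      exact hm
  have hpa : ∀ u v, F'.Adj u v → |p u - p v| = 1 := fun u v h => (hp u v).1 h
  have hreach : ∀ u v, Brk u v → F'.Reachable u v := by
    intro u v hb
    obtain ⟨a, b, hab, ha, hb'⟩ := hb.1 u (SimpleGraph.Reachable.refl _)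
    have : ∃ y, F.Adj u y ∧ y ≠ v := by
      by_cases h : a = v
      · exact ⟨b, hb', fun h' => hab (h.trans h'.symm)⟩
      · exact ⟨a, ha, h⟩
    obtain ⟨y, hy, hyv⟩ := this
    have hy' : F'.Adj u y := by
      refine ⟨hy, fun h => hyv ?_, fun h => hyv ?_⟩
      · exact (hU _ _ _ _ h hb (SimpleGraph.Reachable.refl _)).2
      · have := (hU _ _ _ _ hb h hy.reachable)
        exact absurd this.1 hy.ne
    rcases abs_eq (by norm_num : (0:ℤ) ≤ 1) |>.1 (hpa u y hy') with h | h
    · refine hend (fun x => - p x) (neg_injective.comp hinj) ?_ u v y hb hy' (by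
        omega)
      intro a b h
      rw [← hpa a b h, ← abs_neg]
      congr 1
      ring
    · exact hend p hinj hpa u v y hb hy' (by omega)
  exact ⟨{ p := p, Brk := Brk, inj := hinj
           adj_of_near := fun u v h => ((hp u v).2 h).1
           near_or_brk := fun u v h => by
             by_contra! hcon
             exact hcon.1 ((hp u v).1 ⟨h, hcon.2⟩)
           brk_adj := fun u v h => (hB u v h).1
           brk_not_near := fun u v h h' => ((hp u v).2 h').2.1 h
           brk_two := fun u v h => h.1
           brk_min := fun u v h => (hB u v h).2
           brk_between := fun u v h z hz =>
             (reachable_of_label_between hinj hpa (hreach u v h) hz).mono hle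
           brk_unique := hU }⟩

/-! ### Two-colouring hypergraphs of node degree two -/

/-- Colours are fixed in order of decreasing `d`: when `n` is recoloured, its constraint involves `g
n`, which is either unconstrained or already settled. -/
theorem exists_bool_coloring_of_increasing {N : Type*} [Finite N] (S : N → Prop) (g : N → N)
    (d : N → ℕ) (h : ∀ n, S n → S (g n) → d n < d (g n)) :
    ∃ κ : N → Bool, ∀ n, S n → κ n = !κ (g n) := by
  classical
  cases nonempty_fintype N
  obtain ⟨D, hD⟩ : ∃ D, ∀ n, d n < D := ⟨∑ n, d n + 1, fun n => Nat.lt_succ_of_le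
    (Finset.single_le_sum (f := d) (fun _ _ => Nat.zero_le _) (Finset.mem_univ n))⟩
  have key : ∀ k, ∃ κ : N → Bool, ∀ n, S n → D ≤ d n + k → κ n = !κ (g n) := by
    intro k
    induction k with
    | zero => exact ⟨fun _ => true, fun n _ hn => absurd (hD n) (by omega)⟩
    | succ k ih =>
      obtain ⟨κ, hκ⟩ := ih
      refine ⟨fun n => if S n ∧ d n + k + 1 = D then !κ (g n) else κ n, fun n hn hd => ?_⟩
      have hg : ¬ (S (g n) ∧ d (g n) + k + 1 = D) := by
        rintro ⟨h1, h2⟩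
        have := h n hn h1
        omega
      simp only [hg, if_false]
      by_cases he : d n + k + 1 = D
      · simp [hn, he]
      · simp only [he, and_false, if_false]
        exact hκ n hn (by omega)
  obtain ⟨κ, hκ⟩ := key D
  exact ⟨κ, fun n hn => hκ n hn (by omega)⟩

theorem exists_adj_dist_succ {V : Type*} {F : SimpleGraph V} {r x : V} (h : F.Reachable r x)
    (hne : r ≠ x) : ∃ y, F.Adj x y ∧ F.dist r x = F.dist r y + 1 := by
  obtain ⟨q, hq⟩ := h.symm.exists_walk_length_eq_dist
  cases q with
  | nil => exact absurd rfl hne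
  | @cons _ y _ ha q =>
    refine ⟨y, ha, ?_⟩
    have h1 := SimpleGraph.dist_le q
    rw [SimpleGraph.Walk.length_cons] at hq
    have h2 : F.dist x r ≤ F.dist y r + 1 := by
      obtain ⟨q', hq'⟩ := q.reachable.exists_walk_length_eq_dist
      have := SimpleGraph.dist_le (SimpleGraph.Walk.cons ha q')
      rw [SimpleGraph.Walk.length_cons] at this
      omega
    rw [SimpleGraph.dist_comm (u := r), SimpleGraph.dist_comm (u := r)]
    omega

/-- The incidence graph of a relation between two types. -/
def incidenceBip {E N : Type*} (R : E → N → Prop) : SimpleGraph (E ⊕ N) :=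
  SimpleGraph.mk (fun x y => match x, y with
    | Sum.inl c, Sum.inr n => R c n
    | Sum.inr n, Sum.inl c => R c n
    | _, _ => False)
  ⟨fun x y h => by cases x <;> cases y <;> exact h⟩ ⟨fun x h => by cases x <;> exact h⟩

/-- Hyperedges `E` over nodes `N` in which every node has degree at most two: the nodes can be
two-coloured so that, except for one root in each component, no hyperedge is monochromatic, and the
hyperedges can be ranked so that roots come first. -/
theorem exists_rooted_coloring {E N : Type*} [Finite E] [Finite N] (R : E → N → Prop)
    (pref : E → Prop) (h0 : ∀ c, ∃ n, R c n)
    (h2 : ∀ n a b c, R a n → R b n → R c n → a = b ∨ a = c ∨ b = c)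
    (h1 : ∀ c n, R c n → (∀ m, R c m → m = n) → ∀ c', R c' n → c' = c) :
    ∃ (κ : N → Bool) (ρ : E → ℕ) (root : E → Prop) (bE : E → ℕ) (bN : N → ℕ),
      Function.Injective ρ ∧ (∀ c n, R c n → bE c = bN n) ∧
      (∀ c, ¬ root c → ∃ n m, R c n ∧ R c m ∧ κ n ≠ κ m) ∧
      ∀ c, root c → ∀ c', c' ≠ c → bE c' = bE c →
        ¬ root c' ∧ (pref c' → pref c) ∧ ρ c < ρ c' := by
  classical
  cases nonempty_fintype E
  cases nonempty_fintype N
  set Γ := incidenceBip R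
  have hll : ∀ c c', ¬ Γ.Adj (Sum.inl c) (Sum.inl c') := fun c n => id
  have hrr : ∀ c c', ¬ Γ.Adj (Sum.inr c) (Sum.inr c') := fun c n => id
  have hch : ∀ K : Γ.ConnectedComponent, ∃ o : E ⊕ N, (∀ c,
      Γ.connectedComponentMk (Sum.inl c) = K → ∃ r, o = Sum.inl r ∧
        Γ.connectedComponentMk (Sum.inl r) = K ∧ (pref c → pref r)) := by
    intro K
    by_cases hp : ∃ c, Γ.connectedComponentMk (Sum.inl c) = K ∧ pref c
    · obtain ⟨r, hr, hr'⟩ := hp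
      exact ⟨Sum.inl r, fun c _ => ⟨r, rfl, hr, fun _ => hr'⟩⟩
    · by_cases hp' : ∃ c, Γ.connectedComponentMk (Sum.inl c) = K
      · obtain ⟨r, hr⟩ := hp'
        exact ⟨Sum.inl r, fun c hc => ⟨r, rfl, hr, fun h => absurd ⟨c, hc, h⟩ hp⟩⟩
      · obtain ⟨o, -⟩ := K.exists_rep
        exact ⟨o, fun c hc => absurd ⟨c, hc⟩ hp'⟩
  choose o ho using hch
  have hroot : ∀ c, ∃ r, o (Γ.connectedComponentMk (Sum.inl c)) = Sum.inl r ∧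
      Γ.Reachable (Sum.inl r) (Sum.inl c) ∧ (pref c → pref r) := by
    intro c
    obtain ⟨r, h, h', h''⟩ := ho _ c rfl
    exact ⟨r, h, SimpleGraph.ConnectedComponent.exact h', h''⟩
  -- Distance from the root of the component. Every other hyperedge gets a parent node one step
  -- closer, and every node of a hyperedge gets a parent hyperedge.
  let d : E ⊕ N → ℕ := fun x => Γ.dist (o (Γ.connectedComponentMk x)) x
  let root : E → Prop := fun c => o (Γ.connectedComponentMk (Sum.inl c)) = Sum.inl c
  have hstep : ∀ x r, o (Γ.connectedComponentMk x) = Sum.inl r → Γ.Reachable (Sum.inl r) x →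
      Sum.inl r ≠ x → ∃ y, Γ.Adj x y ∧ d x = d y + 1 := by
    intro x r hr hreach hne
    obtain ⟨y, hy, hd⟩ := exists_adj_dist_succ hreach hne
    refine ⟨y, hy, ?_⟩
    simp only [d]
    rw [← SimpleGraph.ConnectedComponent.sound hy.reachable, hr]
    exact hd
  have hparE : ∀ c, ¬ root c → ∃ n, R c n ∧ d (Sum.inl c) = d (Sum.inr n) + 1 := by
    intro c hc
    obtain ⟨r, hr, hreach, -⟩ := hroot c
    obtain ⟨y, hy, hd⟩ := hstep (Sum.inl c) r hr hreach (fun h => hc (hr.trans h))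
    cases y with
    | inl y => exact absurd hy (hll _ _)
    | inr n => exact ⟨n, hy, hd⟩
  have hparN : ∀ c n, R c n → ∃ c', R c' n ∧ d (Sum.inr n) = d (Sum.inl c') + 1 := by
    intro c n hcn
    obtain ⟨r, hr, hreach, -⟩ := hroot c
    have hcn' : Γ.Adj (Sum.inl c) (Sum.inr n) := hcn
    obtain ⟨y, hy, hd⟩ := hstep (Sum.inr n) r
      (by rw [← SimpleGraph.ConnectedComponent.sound hcn'.reachable, hr])
      (hreach.trans hcn'.reachable) (by simp)
    cases y with
    | inl y => exact ⟨y, hy, hd⟩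
    | inr n => exact absurd hy (hrr _ _)
  have hpar' : ∀ c, ∃ n, ¬ root c → R c n ∧ d (Sum.inl c) = d (Sum.inr n) + 1 := by
    intro c
    by_cases hc : root c
    · exact ⟨(h0 c).choose, fun h => absurd hc h⟩
    · obtain ⟨n, hn⟩ := hparE c hc
      exact ⟨n, fun _ => hn⟩
  choose par hpar using hpar'
  -- Two children and the parent hyperedge would give the node degree three.
  have hparinj : ∀ c c', ¬ root c → ¬ root c' → par c = par c' → c = c' := by
    intro c c' hc hc' h
    obtain ⟨h3, h4⟩ := hpar c hc
    obtain ⟨h5, h6⟩ := hpar c' hc'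
    rw [← h] at h5 h6
    obtain ⟨c'', h7, h8⟩ := hparN _ _ h3
    rcases h2 _ _ _ _ h3 h5 h7 with rfl | rfl | rfl
    · rfl
    · omega
    · omega
  -- If `par c` were the only node of `c`, then by `h1` no other hyperedge would contain it, yet it
  -- has a parent hyperedge.
  have hn2 : ∀ c, ¬ root c → ∃ m, R c m ∧ m ≠ par c := by
    intro c hc
    by_contra! hcon
    obtain ⟨h3, h4⟩ := hpar c hc
    obtain ⟨c'', h7, h8⟩ := hparN _ _ h3
    have := h1 c _ h3 hcon c'' h7
    subst this
    omega
  have hn2' : ∀ c, ∃ m, ¬ root c → R c m ∧ m ≠ par c := by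
    intro c
    by_cases hc : root c
    · exact ⟨par c, fun h => absurd hc h⟩
    · obtain ⟨m, hm⟩ := hn2 c hc
      exact ⟨m, fun _ => hm⟩
  choose n2 hn2 using hn2'
  let S : N → Prop := fun n => ∃ c, ¬ root c ∧ par c = n
  let g : N → N := fun n => if h : S n then n2 h.choose else n
  have hg : ∀ c, ¬ root c → g (par c) = n2 c := by
    intro c hc
    have hS : S (par c) := ⟨c, hc, rfl⟩
    simp only [g, hS, dif_pos]
    congr 1
    exact hparinj _ _ hS.choose_spec.1 hc hS.choose_spec.2
  -- It suffices that `par c` and `n2 c` differ in colour. If `n2 c` is itself a parent node, its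
  -- degree bound forces `c` to be its own parent hyperedge, so it is farther from the root than
  -- `par c`.
  obtain ⟨κ, hκ⟩ := exists_bool_coloring_of_increasing S g (fun n => d (Sum.inr n)) (by
    rintro n ⟨c, hc, rfl⟩
    rw [hg c hc]
    rintro ⟨c', hc', h⟩
    obtain ⟨h3, h4⟩ := hpar c hc
    obtain ⟨h5, h6⟩ := hpar c' hc'
    obtain ⟨h7, h8⟩ := hn2 c hc
    rw [h] at h5 h6
    obtain ⟨c'', h9, h10⟩ := hparN _ _ h7
    rcases h2 _ _ _ _ h7 h5 h9 with rfl | rfl | rfl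
    · exact absurd h.symm h8
    · omega
    · omega)
  -- The rank orders by distance, with an index below `Fintype.card E` to break ties; the root has
  -- distance zero and so comes first in its component.
  refine ⟨κ, fun c => d (Sum.inl c) * (Fintype.card E + 1) + Fintype.equivFin E c, root,
    fun c => Fintype.equivFin _ (Γ.connectedComponentMk (Sum.inl c)),
    fun n => Fintype.equivFin _ (Γ.connectedComponentMk (Sum.inr n)), ?_, ?_, ?_, ?_⟩
  · intro a b hab
    simp only at hab
    have ha := (Fintype.equivFin E a).2
    have hb := (Fintype.equivFin E b).2
    apply (Fintype.equivFin E).injective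
    ext
    have := congrArg (· % (Fintype.card E + 1)) hab
    simp only [Nat.mul_add_mod_self_right] at this
    rwa [Nat.mod_eq_of_lt (by omega), Nat.mod_eq_of_lt (by omega)] at this
  · intro c n hcn
    have hcn' : Γ.Adj (Sum.inl c) (Sum.inr n) := hcn
    simp only
    rw [SimpleGraph.ConnectedComponent.sound hcn'.reachable]
  · intro c hc
    refine ⟨par c, n2 c, (hpar c hc).1, (hn2 c hc).1, ?_⟩
    have := hκ (par c) ⟨c, hc, rfl⟩
    rw [hg c hc] at this
    simp [this]
  · intro c hc c' hne hb
    simp only at hb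
    have hb' : Γ.connectedComponentMk (Sum.inl c') = Γ.connectedComponentMk (Sum.inl c) := by
      apply (Fintype.equivFin _).injective
      ext
      exact hb
    have hnr : ¬ root c' := by
      intro h
      have : o _ = _ := h
      rw [hb', hc] at this
      exact hne (Sum.inl_injective this).symm
    refine ⟨hnr, fun h => ?_, ?_⟩
    · obtain ⟨r, hr, -, hp⟩ := hroot c'
      rw [hb', hc] at hr
      exact Sum.inl_injective hr ▸ hp h
    · have h3 : d (Sum.inl c) = 0 := by
        have : o _ = _ := hc
        simp only [d, this]
        exact SimpleGraph.dist_self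
      have h4 := (hpar c' hnr).2
      have ha := (Fintype.equivFin E c).2
      beta_reduce
      rw [h3, h4]
      nlinarith

/-! ### The saturated set -/

theorem sum_card_filter_adj_insert {V : Type*} [DecidableEq V] (G : SimpleGraph V)
    [DecidableRel G.Adj] (D : Finset V) {a : V} (ha : a ∉ D) :
    ∑ v ∈ insert a D, ((insert a D).filter (G.Adj v)).card =
      ∑ v ∈ D, (D.filter (G.Adj v)).card + 2 * (D.filter (G.Adj a)).card := by
  have h1 : ∀ v, ((insert a D).filter (G.Adj v)).card =
      (D.filter (G.Adj v)).card + if G.Adj v a then 1 else 0 := by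
    intro v
    rw [Finset.filter_insert]
    split_ifs
    · rw [Finset.card_insert_of_notMem (by simp [ha])]
    · rfl
  rw [Finset.sum_insert ha, Finset.sum_congr rfl (fun v _ => h1 v), h1 a,
    Finset.sum_add_distrib, if_neg (G.loopless.irrefl a), ← Finset.card_filter]
  simp only [G.adj_comm _ a]
  ring

/-- In a cubic graph there is a vertex set inducing maximum degree at most two such that every
outside vertex has a neighbour in the set having degree two in the set. -/
theorem exists_saturated_set {V : Type*} [Fintype V] (G : SimpleGraph V) [DecidableRel G.Adj]
    (hG : ∀ v, (Finset.univ.filter (G.Adj v)).card ≤ 3) :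
    ∃ C : V → Prop,
      (∀ u a b c, C u → C a → C b → C c → G.Adj u a → G.Adj u b → G.Adj u c →
        a = b ∨ a = c ∨ b = c) ∧
      ∀ a, ¬ C a → ∃ x y z, C x ∧ C y ∧ C z ∧ G.Adj a x ∧ y ≠ z ∧ G.Adj x y ∧ G.Adj x z := by
  classical
  let ok : Finset V → Prop := fun C => ∀ v ∈ C, (C.filter (G.Adj v)).card ≤ 2
  let e : Finset V → ℕ := fun C => ∑ v ∈ C, (C.filter (G.Adj v)).card
  -- Since `e C` is at most twice the number of vertices, this weight compares cardinalities first
  -- and degree sums second.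
  obtain ⟨C, hC, hmax⟩ := Finset.exists_max_image (Finset.univ.filter ok)
    (fun C => (2 * Fintype.card V + 1) * C.card + e C) ⟨∅, by simp [ok]⟩
  simp only [Finset.mem_filter, Finset.mem_univ, true_and] at hC hmax
  refine ⟨fun v => v ∈ C, ?_, ?_⟩
  · intro u a b c hu ha hb hc hua hub huc
    by_contra! hcon
    have := Finset.card_le_card (s := {a, b, c}) (t := C.filter (G.Adj u)) (by
      intro x hx
      simp only [Finset.mem_insert, Finset.mem_singleton] at hx
      rcases hx with rfl | rfl | rfl <;> simp [*])
    rw [Finset.card_eq_three.2 ⟨a, b, c, hcon.1, hcon.2.1, hcon.2.2, rfl⟩] at this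
    have := hC u hu
    omega
  · intro a ha
    by_contra! hcon
    have h1 : ∀ v ∈ C, G.Adj v a → (C.filter (G.Adj v)).card ≤ 1 := by
      intro v hv hva
      by_contra! h
      obtain ⟨y, z, hyz, h⟩ := Finset.card_eq_two.1 (le_antisymm (hC v hv) h)
      have hy : y ∈ C.filter (G.Adj v) := by rw [h]; simp
      have hz : z ∈ C.filter (G.Adj v) := by rw [h]; simp
      simp only [Finset.mem_filter] at hy hz
      exact hcon v y z hv hy.1 hz.1 hva.symm hyz hy.2 hz.2
    have hins : ∀ D ⊆ C, ∀ v ∈ D, ((insert a D).filter (G.Adj v)).card ≤ 2 := by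
      intro D hD v hv
      have hle := Finset.card_le_card (Finset.filter_subset_filter (G.Adj v) hD)
      rw [Finset.filter_insert]
      split_ifs with hva
      · have := Finset.card_insert_le a (D.filter (G.Adj v))
        have := h1 v (hD hv) hva
        omega
      · exact hle.trans (hC v (hD hv))
    -- With at most two neighbours in `C`, the vertex `a` could simply be added.
    by_cases hS : (C.filter (G.Adj a)).card ≤ 2
    · have h2 := hmax (insert a C) (by
        intro v hv
        rcases Finset.mem_insert.1 hv with rfl | hv
        · rwa [Finset.filter_insert, if_neg (G.loopless.irrefl v)]
        · exact hins C subset_rfl v hv)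
      have h3 : e C ≤ 2 * Fintype.card V := by
        calc e C ≤ C.card • 2 := Finset.sum_le_card_nsmul _ _ _ hC
          _ ≤ _ := by
            have := Finset.card_le_univ C
            simp only [smul_eq_mul]
            omega
      rw [Finset.card_insert_of_notMem ha] at h2
      nlinarith
    -- With three neighbours, exchange one of them, `c`, for `a`: the degree sum loses at most `2`
    -- and gains `4`.
    · have hpos : 0 < (C.filter (G.Adj a)).card := by omega
      obtain ⟨c, hc⟩ := Finset.card_pos.1 hpos
      rw [Finset.mem_filter] at hc
      have haD : a ∉ C.erase c := fun h => ha (Finset.mem_of_mem_erase h)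
      have hDa : ((C.erase c).filter (G.Adj a)).card = 2 := by
        rw [Finset.filter_erase, Finset.card_erase_of_mem (by simp [hc])]
        have : (C.filter (G.Adj a)).card ≤ 3 :=
          (Finset.card_le_card (Finset.filter_subset_filter _ (Finset.subset_univ C))).trans (hG a)
        omega
      have h2 := hmax (insert a (C.erase c)) (by
        intro v hv
        rcases Finset.mem_insert.1 hv with rfl | hv
        · rw [Finset.filter_insert, if_neg (G.loopless.irrefl v)]
          omega
        · exact hins _ (Finset.erase_subset _ _) v hv)
      have h3 := sum_card_filter_adj_insert G (C.erase c) haD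
      have h4 := sum_card_filter_adj_insert G (C.erase c) (Finset.notMem_erase c C)
      rw [Finset.insert_erase hc.1] at h4
      have h5 := h1 c hc.1 hc.2.symm
      have h6 : ((C.erase c).filter (G.Adj c)).card ≤ (C.filter (G.Adj c)).card :=
        Finset.card_le_card (Finset.filter_subset_filter _ (Finset.erase_subset _ _))
      rw [Finset.card_insert_of_notMem haD, Finset.card_erase_add_one hc.1] at h2
      have h7 : e (insert a (C.erase c)) ≤ e C := by omega
      simp only [e] at h7
      omega

/-! ### Colouring and ranking around the thick vertices -/

/-- `c` belongs to `C` and has two neighbours outside `C`. -/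
def IsMulti {V : Type*} (G : SimpleGraph V) (C : V → Prop) (c : V) : Prop :=
  C c ∧ ∃ a b, a ≠ b ∧ ¬ C a ∧ ¬ C b ∧ G.Adj c a ∧ G.Adj c b

/-- `c` is isolated in `C` and has two neighbours outside `C`. -/
def IsFar {V : Type*} (G : SimpleGraph V) (C : V → Prop) (c : V) : Prop :=
  IsMulti G C c ∧ ∀ d, C d → ¬ G.Adj c d

/-- The graph `G` with only the edges inside `S`. -/
def graphOn {V : Type*} (G : SimpleGraph V) (S : V → Prop) : SimpleGraph V :=
  SimpleGraph.mk (fun a b => S a ∧ S b ∧ G.Adj a b) ⟨fun _ _ h => ⟨h.2.1, h.1, h.2.2.symm⟩⟩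
    ⟨fun _ h => h.2.2.ne rfl⟩

/-- A component `K` of `A` has at least `|K| - 1` edges, hence degree sum at least `2|K| - 2`.
Degrees and `M`-slots together total at most `2|K|`, leaving at most two slots. -/
theorem no_three_slots {V : Type*} [Fintype V] (A : SimpleGraph V)
    (M : V → V → Prop)
    (hcnt : ∀ a b c d, (A.Adj a b ∨ M a b) → (A.Adj a c ∨ M a c) → (A.Adj a d ∨ M a d) →
      b = c ∨ b = d ∨ c = d)
    (hdis : ∀ a b, A.Adj a b → ¬ M a b)
    {a b c x y z : V} (hab : A.Reachable a b) (hac : A.Reachable a c)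
    (hax : M a x) (hby : M b y) (hcz : M c z)
    (h1 : (a, x) ≠ (b, y)) (h2 : (a, x) ≠ (c, z)) (h3 : (b, y) ≠ (c, z)) : False := by
  classical
  set K := A.connectedComponentMk a with hK
  have haK : a ∈ K.supp := rfl
  have hbK : b ∈ K.supp := (SimpleGraph.ConnectedComponent.sound hab).symm
  have hcK : c ∈ K.supp := (SimpleGraph.ConnectedComponent.sound hac).symm
  have hconn : K.toSimpleGraph.Connected := K.connected_toSimpleGraph
  have hcard := hconn.card_vert_le_card_edgeSet_add_one
  have hsum := K.toSimpleGraph.sum_degrees_eq_twice_card_edges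
  rw [Nat.card_eq_fintype_card, Nat.card_eq_fintype_card, ← SimpleGraph.edgeFinset_card] at hcard
  have hloc : ∀ v : K, K.toSimpleGraph.degree v + (Finset.univ.filter (M v.1)).card ≤ 2 := by
    intro v
    have e1 : K.toSimpleGraph.degree v =
        ((K.toSimpleGraph.neighborFinset v).map (Function.Embedding.subtype _)).card := by
      rw [Finset.card_map, SimpleGraph.card_neighborFinset_eq_degree]
    rw [e1, ← Finset.card_union_of_disjoint]
    · by_contra! hcon
      obtain ⟨s, t, u, hs, ht, hu, hst, hsu, htu⟩ := Finset.two_lt_card_iff.1 hcon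
      have hmem : ∀ s, s ∈ (K.toSimpleGraph.neighborFinset v).map (Function.Embedding.subtype _) ∪
          Finset.univ.filter (M v.1) → A.Adj v.1 s ∨ M v.1 s := by
        intro s hs
        rw [Finset.mem_union] at hs
        rcases hs with hs | hs
        · left
          simp only [Finset.mem_map, SimpleGraph.mem_neighborFinset] at hs
          obtain ⟨s', hs', rfl⟩ := hs
          exact hs'
        · right
          simpa using hs
      rcases hcnt v.1 s t u (hmem s hs) (hmem t ht) (hmem u hu) with h | h | h <;> contradiction
    · rw [Finset.disjoint_left]
      intro s hs hs'
      simp only [Finset.mem_map, SimpleGraph.mem_neighborFinset] at hs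
      obtain ⟨s', hs'', rfl⟩ := hs
      exact hdis _ _ hs'' (by simpa using hs')
  have htot := Finset.sum_le_sum (fun v (_ : v ∈ (Finset.univ : Finset K)) => hloc v)
  rw [Finset.sum_add_distrib, hsum, ← Finset.card_sigma] at htot
  simp only [Finset.sum_const, Finset.card_univ, smul_eq_mul] at htot
  have h3 : 2 < ((Finset.univ : Finset K).sigma (fun v => Finset.univ.filter (M v.1))).card := by
    rw [Finset.two_lt_card_iff]
    refine ⟨⟨⟨a, haK⟩, x⟩, ⟨⟨b, hbK⟩, y⟩, ⟨⟨c, hcK⟩, z⟩, by simpa using hax, by simpa using hby,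
      by simpa using hcz, ?_, ?_, ?_⟩
    · intro h
      simp_all
    · intro h
      simp_all
    · intro h
      simp_all
  omega

/-- Finite graph in which four neighbours of a vertex are never distinct, with a set `C` inducing
maximum degree two that is saturated from outside. -/
structure IsSaturated {V : Type*} (G : SimpleGraph V) (C : V → Prop) : Prop where
  deg : ∀ u a b c, G.Adj u a → G.Adj u b → G.Adj u c → a ≠ b → a ≠ c → b ≠ c →
    ∀ d, G.Adj u d → d = a ∨ d = b ∨ d = c
  degC : ∀ u a b c, C u → C a → C b → C c → G.Adj u a → G.Adj u b → G.Adj u c →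
    a = b ∨ a = c ∨ b = c
  sat : ∀ a, ¬ C a → ∃ x y z, C x ∧ C y ∧ C z ∧ G.Adj a x ∧ y ≠ z ∧ G.Adj x y ∧ G.Adj x z

/-- The component colouring and ranking used to arrange the vertices outside `C`. -/
structure ThickColoring {V : Type*} (G : SimpleGraph V) (C : V → Prop) where
  col : V → Bool
  ρ : V → ℕ
  root : V → Prop
  blk : V → ℕ
  adj_col : ∀ a b, ¬ C a → ¬ C b → G.Adj a b → col a = col b
  adj_blk : ∀ a b, ¬ C a → ¬ C b → G.Adj a b → blk a = blk b
  multi_blk : ∀ c a, IsMulti G C c → ¬ C a → G.Adj c a → blk c = blk a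
  inj : ∀ c d, IsMulti G C c → IsMulti G C d → ρ c = ρ d → c = d
  nonmono : ∀ c, IsMulti G C c → ¬ root c →
    ∃ a b, ¬ C a ∧ ¬ C b ∧ G.Adj c a ∧ G.Adj c b ∧ col a ≠ col b
  of_root : ∀ c d, IsMulti G C c → IsMulti G C d → root c → d ≠ c → blk d = blk c →
    ¬ root d ∧ (IsFar G C d → IsFar G C c) ∧ ρ c < ρ d

/-- The neighbour supplied by saturation has two neighbours in `C`, so `a` is its only neighbour
outside. -/
theorem IsSaturated.exists_nonmulti {V : Type*} {G : SimpleGraph V} {C : V → Prop}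
    (h : IsSaturated G C) {a : V} (ha : ¬ C a) : ∃ x, C x ∧ G.Adj a x ∧ ¬ IsMulti G C x := by
  obtain ⟨x, y, z, hx, hy, hz, hax, hyz, hxy, hxz⟩ := h.sat a ha
  refine ⟨x, hx, hax, ?_⟩
  have key : ∀ b, ¬ C b → G.Adj x b → b = a := by
    intro b hb hxb
    rcases h.deg x y z a hxy hxz hax.symm hyz (by rintro rfl; exact ha hy)
      (by rintro rfl; exact ha hz) b hxb with rfl | rfl | rfl
    · exact absurd hy hb
    · exact absurd hz hb
    · rfl
  rintro ⟨-, b, c, hbc, hb, hc, hxb, hxc⟩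
  exact hbc ((key b hb hxb).trans (key c hc hxc).symm)

/-- Apply `exists_rooted_coloring` to the hypergraph whose nodes are the components outside `C` and
whose hyperedges are the `IsMulti` vertices, preferring far vertices as roots. -/
theorem IsSaturated.nonempty_thickColoring {V : Type*} [Finite V] {G : SimpleGraph V}
    {C : V → Prop} (h : IsSaturated G C) : Nonempty (ThickColoring G C) := by
  classical
  cases nonempty_fintype V
  set A := graphOn G (fun v => ¬ C v)
  let M : V → V → Prop := fun a x => ¬ C a ∧ IsMulti G C x ∧ G.Adj a x
  have hslots : ∀ {a b c x y z}, A.Reachable a b → A.Reachable a c → M a x → M b y → M c z →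
      (a, x) ≠ (b, y) → (a, x) ≠ (c, z) → (b, y) ≠ (c, z) → False := by
    intro a b c x y z
    refine no_three_slots A M ?_ ?_
    · intro a b c d hb hc hd
      by_contra! hcon
      have ha : ¬ C a := by
        rcases hb with hb | hb
        · exact hb.1
        · exact hb.1
      obtain ⟨x, hx, hax, hxm⟩ := h.exists_nonmulti ha
      have key : ∀ b, (A.Adj a b ∨ M a b) → G.Adj a b ∧ x ≠ b := by
        rintro b (hb | hb)
        · exact ⟨hb.2.2, by rintro rfl; exact hb.2.1 hx⟩
        · exact ⟨hb.2.2, by rintro rfl; exact hxm hb.2.1⟩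
      obtain ⟨h1, h1'⟩ := key b hb
      obtain ⟨h2, h2'⟩ := key c hc
      obtain ⟨h3, h3'⟩ := key d hd
      rcases h.deg a b c d h1 h2 h3 hcon.1 hcon.2.1 hcon.2.2 x hax with h | h | h <;>
        contradiction
    · intro a b hab hm
      exact hab.2.1 hm.2.1.1
  let R : {c // IsMulti G C c} → A.ConnectedComponent → Prop :=
    fun c n => ∃ a, ¬ C a ∧ G.Adj c.1 a ∧ A.connectedComponentMk a = n
  obtain ⟨κ, ρ, root, bE, bN, hρ, hb, hmono, hroot⟩ := exists_rooted_coloring R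
    (fun c => IsFar G C c.1) (by
      rintro ⟨c, hc, a, b, -, ha, -, hca, -⟩
      exact ⟨_, a, ha, hca, rfl⟩) (by
      rintro n ⟨c1, h1⟩ ⟨c2, h2⟩ ⟨c3, h3⟩ ⟨a1, ha1, hca1, rfl⟩ ⟨a2, ha2, hca2, hn2⟩
        ⟨a3, ha3, hca3, hn3⟩
      by_contra! hcon
      refine hslots (SimpleGraph.ConnectedComponent.exact hn2.symm)
        (SimpleGraph.ConnectedComponent.exact hn3.symm) ⟨ha1, h1, hca1.symm⟩
        ⟨ha2, h2, hca2.symm⟩ ⟨ha3, h3, hca3.symm⟩ ?_ ?_ ?_ <;> simp_all) (by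
      rintro ⟨c, hc⟩ n - hall ⟨c', hc'⟩ ⟨a', ha', hca', hn⟩
      -- A hyperedge with a single node uses two slots of that component, which leaves none for
      -- another hyperedge.
      obtain ⟨-, a, b, hab, ha, hb, hca, hcb⟩ := id hc
      have h1 := hall _ ⟨a, ha, hca, rfl⟩
      have h2 := hall _ ⟨b, hb, hcb, rfl⟩
      by_contra hcon
      refine hslots (SimpleGraph.ConnectedComponent.exact (h1.trans h2.symm))
        (SimpleGraph.ConnectedComponent.exact (h1.trans hn.symm)) ⟨ha, hc, hca.symm⟩
        ⟨hb, hc, hcb.symm⟩ ⟨ha', hc', hca'.symm⟩ ?_ ?_ ?_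
      · simp [hab]
      · rintro h
        simp_all
      · rintro h
        simp_all)
  refine ⟨{ col := fun a => κ (A.connectedComponentMk a)
            ρ := fun c => if hc : IsMulti G C c then ρ ⟨c, hc⟩ else 0
            root := fun c => ∃ hc : IsMulti G C c, root ⟨c, hc⟩
            blk := fun v => if hc : IsMulti G C v then bE ⟨v, hc⟩ else
              bN (A.connectedComponentMk v)
            adj_col := ?_, adj_blk := ?_, multi_blk := ?_, inj := ?_, nonmono := ?_
            of_root := ?_ }⟩
  · intro a b ha hb hab
    have : A.Adj a b := ⟨ha, hb, hab⟩
    simp only [SimpleGraph.ConnectedComponent.sound this.reachable]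
  · intro a b ha hb hab
    have : A.Adj a b := ⟨ha, hb, hab⟩
    simp only [dif_neg (fun h : IsMulti G C a => ha h.1), dif_neg (fun h : IsMulti G C b => hb h.1),
      SimpleGraph.ConnectedComponent.sound this.reachable]
  · intro c a hc ha hca
    simp only [dif_pos hc, dif_neg (fun h : IsMulti G C a => ha h.1)]
    exact hb _ _ ⟨a, ha, hca, rfl⟩
  · intro c d hc hd heq
    simp only [dif_pos hc, dif_pos hd] at heq
    simpa using hρ heq
  · intro c hc hr
    obtain ⟨n, m, ⟨a, ha, hca, rfl⟩, ⟨b, hb, hcb, rfl⟩, hne⟩ :=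
      hmono ⟨c, hc⟩ (fun h => hr ⟨hc, h⟩)
    exact ⟨a, b, ha, hb, hca, hcb, hne⟩
  · rintro c d hc hd ⟨_, hr⟩ hne hbl
    simp only [dif_pos hc, dif_pos hd] at hbl ⊢
    obtain ⟨h1, h2, h3⟩ := hroot ⟨c, hc⟩ hr ⟨d, hd⟩ (by simpa using hne) hbl
    exact ⟨fun ⟨_, h⟩ => h1 h, h2, h3⟩

/-! ### The link graph -/

/-- `c` links the two equally coloured vertices `u` and `v`, without being a far root. -/
def ThickColoring.Link {V : Type*} {G : SimpleGraph V} {C : V → Prop} (T : ThickColoring G C)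
    (c u v : V) : Prop :=
  IsMulti G C c ∧ ¬ (T.root c ∧ IsFar G C c) ∧ G.Adj c u ∧ G.Adj c v ∧ T.col u = T.col v

/-- The graph on the complement of `C` joining adjacent or linked vertices. -/
def ThickColoring.linkGraph {V : Type*} {G : SimpleGraph V} {C : V → Prop}
    (T : ThickColoring G C) : SimpleGraph V :=
  SimpleGraph.mk (fun u v => u ≠ v ∧ ¬ C u ∧ ¬ C v ∧ (G.Adj u v ∨ ∃ c, T.Link c u v))
    ⟨fun _ _ h => ⟨h.1.symm, h.2.2.1, h.2.1, h.2.2.2.imp (·.symm)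
      (fun ⟨c, h⟩ => ⟨c, h.1, h.2.1, h.2.2.2.1, h.2.2.1, h.2.2.2.2.symm⟩)⟩⟩
    ⟨fun _ h => h.1 rfl⟩

/-- With three neighbours of one colour outside `C`, a non-root would be monochromatic, and a root
would be far. -/
theorem IsSaturated.not_three {V : Type*} {G : SimpleGraph V}
    {C : V → Prop} (h : IsSaturated G C) (T : ThickColoring G C) {c a1 a2 a3 : V}
    (hc : IsMulti G C c) (hf : ¬ (T.root c ∧ IsFar G C c))
    (h1 : ¬ C a1) (h2 : ¬ C a2) (h3 : ¬ C a3)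
    (hc1 : G.Adj c a1) (hc2 : G.Adj c a2) (hc3 : G.Adj c a3)
    (h12 : a1 ≠ a2) (h13 : a1 ≠ a3) (h23 : a2 ≠ a3)
    (hk2 : T.col a1 = T.col a2) (hk3 : T.col a1 = T.col a3) : False := by
  have hN := h.deg c a1 a2 a3 hc1 hc2 hc3 h12 h13 h23
  by_cases hr : T.root c
  · refine hf ⟨hr, hc, fun d hd hcd => ?_⟩
    rcases hN d hcd with rfl | rfl | rfl <;> contradiction
  · obtain ⟨a, b, -, -, ha, hb, hab⟩ := T.nonmono c hc hr
    rcases hN a ha with rfl | rfl | rfl <;> rcases hN b hb with rfl | rfl | rfl <;> grind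

/-- Send each link-graph neighbour of `u` to the neighbour of `u` in `G` that realizes it: itself or
a link. By `not_three` this is injective, and it misses the neighbour from `exists_nonmulti`, so at
most two values remain. -/
theorem IsSaturated.linkGraph_deg {V : Type*} {G : SimpleGraph V}
    {C : V → Prop} (h : IsSaturated G C) (T : ThickColoring G C) {u v1 v2 v3 : V}
    (h1 : T.linkGraph.Adj u v1) (h2 : T.linkGraph.Adj u v2) (h3 : T.linkGraph.Adj u v3) :
    v1 = v2 ∨ v1 = v3 ∨ v2 = v3 := by
  by_contra! hcon
  obtain ⟨h12, h13, h23⟩ := hcon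
  obtain ⟨x, hx, hux, hxm⟩ := h.exists_nonmulti h1.2.1
  have key : ∀ v, T.linkGraph.Adj u v → ∃ f, G.Adj u f ∧ f ≠ x ∧ (f = v ∨ T.Link f u v) := by
    rintro v ⟨-, -, hv, huv | ⟨c, hc⟩⟩
    · exact ⟨v, huv, by rintro rfl; exact hv hx, Or.inl rfl⟩
    · exact ⟨c, hc.2.2.1.symm, by rintro rfl; exact hxm hc.1, Or.inr hc⟩
  have hinj : ∀ v v', T.linkGraph.Adj u v → T.linkGraph.Adj u v' → v ≠ v' → ∀ f f',
      (f = v ∨ T.Link f u v) → (f' = v' ∨ T.Link f' u v') → f ≠ f' := by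
    rintro v v' hv hv' hne f f' hf hf' rfl
    rcases hf with rfl | hf
    · rcases hf' with rfl | hf'
      · exact hne rfl
      · exact hv.2.2.1 hf'.1.1
    · rcases hf' with rfl | hf'
      · exact hv'.2.2.1 hf.1.1
      · exact h.not_three T hf.1 hf.2.1 hv.2.1 hv.2.2.1 hv'.2.2.1 hf.2.2.1 hf.2.2.2.1
          hf'.2.2.2.1 hv.1 hv'.1 hne hf.2.2.2.2 hf'.2.2.2.2
  obtain ⟨f1, hf1, hx1, hl1⟩ := key _ h1
  obtain ⟨f2, hf2, hx2, hl2⟩ := key _ h2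
  obtain ⟨f3, hf3, hx3, hl3⟩ := key _ h3
  rcases h.deg u f1 f2 f3 hf1 hf2 hf3 (hinj _ _ h1 h2 h12 _ _ hl1 hl2)
    (hinj _ _ h1 h3 h13 _ _ hl1 hl3) (hinj _ _ h2 h3 h23 _ _ hl2 hl3) x hux with rfl | rfl | rfl <;>
    contradiction

/-! ### The order of the thick vertices -/

/-- A linear order of the vertices outside `C`, with noncrossing edges, in which a vertex between
two equally coloured neighbours of `c` has all its neighbours in `C` after `c`. -/
structure ThickOrder {V : Type*} (G : SimpleGraph V) (C : V → Prop) where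
  col : V → Bool
  q : V → ℤ
  N : ℤ
  ρ : V → ℕ
  lower : ∀ a, ¬ C a → 3 ≤ q a
  upper : ∀ a, ¬ C a → q a + 3 ≤ N
  inj : ∀ a b, ¬ C a → ¬ C b → q a = q b → a = b
  adj_col : ∀ a b, ¬ C a → ¬ C b → G.Adj a b → col a = col b
  noncross : ∀ a a' b b', ¬ C a → ¬ C a' → ¬ C b → ¬ C b' → G.Adj a a' → G.Adj b b' →
    q b' < q a → q a < q b → q b < q a' → False
  ρ_inj : ∀ c d, IsFar G C c → IsFar G C d → ρ c = ρ d → c = d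
  between : ∀ c u v a, C c → ¬ C u → ¬ C v → ¬ C a → G.Adj c u → G.Adj c v → col u = col v →
    q u < q a → q a < q v → ∀ d, C d → G.Adj a d →
    d = c ∨ (IsFar G C c ∧ (¬ IsFar G C d ∨ ρ c < ρ d))

/-- Adjacent pairs get priority zero, linked pairs the rank of their first link. -/
noncomputable def ThickColoring.weight {V : Type*} {G : SimpleGraph V} {C : V → Prop}
    (T : ThickColoring G C) (u v : V) : ℕ :=
  open Classical in
  if G.Adj u v then 0 else 1 + sInf {n | ∃ c, T.Link c u v ∧ T.ρ c = n}

theorem ThickColoring.Link.symm {V : Type*} {G : SimpleGraph V} {C : V → Prop}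
    {T : ThickColoring G C} {c u v : V} (h : T.Link c u v) : T.Link c v u :=
  ⟨h.1, h.2.1, h.2.2.2.1, h.2.2.1, h.2.2.2.2.symm⟩

theorem ThickColoring.blk_eq_of_reachable {V : Type*} {G : SimpleGraph V} {C : V → Prop}
    (T : ThickColoring G C) {u v : V} (h : T.linkGraph.Reachable u v) : T.blk u = T.blk v := by
  obtain ⟨w⟩ := h
  induction w with
  | nil => rfl
  | cons ha _ ih =>
    refine Eq.trans ?_ ih
    rcases ha.2.2.2 with h | ⟨c, hc⟩
    · exact T.adj_blk _ _ ha.2.1 ha.2.2.1 h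
    · exact (T.multi_blk c _ hc.1 ha.2.1 hc.2.2.1).symm.trans
        (T.multi_blk c _ hc.1 ha.2.2.1 hc.2.2.2.1)

/-- A vertex lying between the ends of a broken linked pair sees only vertices after the link. -/
theorem IsSaturated.after_of_broken {V : Type*} {G : SimpleGraph V}
    {C : V → Prop} (h : IsSaturated G C) (T : ThickColoring G C)
    (L : BrokenLayout T.linkGraph T.weight) {c u v a : V} (hc : T.Link c u v) (hb : L.Brk u v)
    (ha : ¬ C a) (hua : T.linkGraph.Reachable u a) (hau : a ≠ u) (hav : a ≠ v) {d : V}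
    (had : G.Adj a d) : IsFar G C c ∧ (¬ IsFar G C d ∨ T.ρ c < T.ρ d) := by
  classical
  have huv := L.brk_adj u v hb
  have hself := SimpleGraph.Reachable.refl (G := T.linkGraph) u
  obtain ⟨y, hy, hyv⟩ : ∃ y, T.linkGraph.Adj u y ∧ y ≠ v := by
    obtain ⟨s, t, hst, hs, ht⟩ := L.brk_two u v hb u hself
    by_cases hsv : s = v
    · exact ⟨t, ht, fun h => hst (hsv.trans h.symm)⟩
    · exact ⟨s, hs, hsv⟩
  obtain ⟨x, hx, hux, hxm⟩ := h.exists_nonmulti huv.2.1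
  -- The link is the only reason for `u` and `v` to be joined.
  have honly : ∀ f, G.Adj u f → f ≠ x → f ≠ c → f ≠ v ∧ ¬ T.Link f u v := by
    intro f hf hfx hfc
    by_contra! hcon
    have hN := h.deg u x c f hux hc.2.2.1.symm hf (by rintro rfl; exact hxm hc.1)
      hfx.symm hfc.symm
    have hfy : ∀ g, (g = y ∨ T.Link g u y) → G.Adj u g → False := by
      rintro g (rfl | hg) hug
      · rcases hN g hug with rfl | rfl | rfl
        · exact hy.2.2.1 hx
        · exact hy.2.2.1 hc.1.1
        · exact hy.2.2.1 (hcon hyv).1.1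
      · rcases hN g hug with rfl | rfl | rfl
        · exact hxm hg.1
        · exact h.not_three T hg.1 hg.2.1 huv.2.1 huv.2.2.1 hy.2.2.1 hg.2.2.1 hc.2.2.2.1
            hg.2.2.2.1 huv.1 hy.1 hyv.symm hc.2.2.2.2 hg.2.2.2.2
        · by_cases hgv : g = v
          · exact huv.2.2.1 (hgv ▸ hg.1.1)
          · exact h.not_three T hg.1 hg.2.1 huv.2.1 huv.2.2.1 hy.2.2.1 hg.2.2.1
              (hcon hgv).2.2.2.1 hg.2.2.2.1 huv.1 hy.1 hyv.symm hc.2.2.2.2 hg.2.2.2.2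
    rcases hy.2.2.2 with huy | ⟨g, hg⟩
    · exact hfy y (Or.inl rfl) huy
    · exact hfy g (Or.inr hg) hg.2.2.1.symm
  have hnadj : ¬ G.Adj u v := by
    intro hadj
    exact (honly v hadj (by rintro rfl; exact huv.2.2.1 hx)
      (by rintro rfl; exact huv.2.2.1 hc.1.1)).1 rfl
  have hw : T.weight u v = 1 + T.ρ c := by
    have : {n | ∃ c, T.Link c u v ∧ T.ρ c = n} = {T.ρ c} := by
      ext n
      simp only [Set.mem_ofPred_eq, Set.mem_singleton_iff]
      constructor
      · rintro ⟨f, hf, rfl⟩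
        by_contra hne
        exact (honly f hf.2.2.1.symm (by rintro rfl; exact hxm hf.1)
          (by rintro rfl; exact hne rfl)).2 hf
      · rintro rfl
        exact ⟨c, hc, rfl⟩
    rw [ThickColoring.weight, if_neg hnadj, this, csInf_singleton]
  -- The broken pair has least weight, and that weight is positive, so its cycle contains no edge of
  -- `G` and all its links rank at least as high as `c`. Equality would give `c` a third neighbour
  -- `a` of the same colour.
  have hlink : ∀ b, T.linkGraph.Adj a b → ∃ f, T.Link f a b ∧ T.ρ c < T.ρ f := by
    intro b hab
    have hmin := L.brk_min u v hb a b hua hab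
    rw [hw] at hmin
    have hnab : ¬ G.Adj a b := by
      intro hadj
      rw [ThickColoring.weight, if_pos hadj] at hmin
      omega
    obtain ⟨f, hf⟩ := hab.2.2.2.resolve_left hnab
    rw [ThickColoring.weight, if_neg hnab] at hmin
    have h1 : T.ρ c ≤ T.ρ f := by
      have : sInf {n | ∃ c, T.Link c a b ∧ T.ρ c = n} ≤ T.ρ f := Nat.sInf_le ⟨f, hf, rfl⟩
      omega
    refine ⟨f, hf, lt_of_le_of_ne h1 fun heq => ?_⟩
    obtain rfl := T.inj c f hc.1 hf.1 heq
    have hca := hf.2.2.1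
    by_cases hbl : b = u
    · subst hbl
      exact h.not_three T hc.1 hc.2.1 huv.2.1 huv.2.2.1 ha hc.2.2.1 hc.2.2.2.1 hca
        huv.1 hau.symm hav.symm hc.2.2.2.2 hf.2.2.2.2.symm
    · by_cases hbv : b = v
      · subst hbv
        exact h.not_three T hc.1 hc.2.1 huv.2.1 huv.2.2.1 ha hc.2.2.1 hc.2.2.2.1 hca
          huv.1 hau.symm hav.symm hc.2.2.2.2 (hc.2.2.2.2.trans hf.2.2.2.2.symm)
      · rcases h.deg c u v a hc.2.2.1 hc.2.2.2.1 hca huv.1 hau.symm hav.symm b hf.2.2.2.1 with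
          h' | h' | h'
        · exact hbl h'
        · exact hbv h'
        · exact hab.1 h'.symm
  obtain ⟨b1, b2, hb12, hb1, hb2⟩ := L.brk_two u v hb a hua
  obtain ⟨c1, hc1, hρ1⟩ := hlink b1 hb1
  obtain ⟨c2, hc2, hρ2⟩ := hlink b2 hb2
  have hc12 : c1 ≠ c2 := by
    rintro rfl
    exact h.not_three T hc1.1 hc1.2.1 ha hb1.2.2.1 hb2.2.2.1 hc1.2.2.1 hc1.2.2.2.1 hc2.2.2.2.1
      hb1.1 hb2.1 hb12 hc1.2.2.2.2 hc2.2.2.2.2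
  -- A neighbour of `c` in `C` would leave `c` monochromatic, hence a root. Then `c1`, in the same
  -- block, is not a root; it needs a third neighbour outside `C` in the other colour, so it is far,
  -- and the preference for far roots makes `c` far.
  have hfar : IsFar G C c := by
    refine ⟨hc.1, fun e he hce => ?_⟩
    have hN := h.deg c u v e hc.2.2.1 hc.2.2.2.1 hce huv.1 (by rintro rfl; exact huv.2.1 he)
      (by rintro rfl; exact huv.2.2.1 he)
    have hr : T.root c := by
      by_contra hr
      obtain ⟨s, t, hs, ht, hcs, hct, hst⟩ := T.nonmono c hc.1 hr
      have hk := hc.2.2.2.2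
      rcases hN s hcs with rfl | rfl | rfl <;> rcases hN t hct with rfl | rfl | rfl <;>
        simp_all
    have hblk : T.blk c1 = T.blk c := by
      rw [T.multi_blk c1 a hc1.1 ha hc1.2.2.1, T.multi_blk c u hc.1 huv.2.1 hc.2.2.1,
        T.blk_eq_of_reachable hua]
    obtain ⟨hr1, hf1, -⟩ := T.of_root c c1 hc.1 hc1.1 hr (by rintro rfl; omega) hblk
    have hcf : ¬ IsFar G C c := fun hf => hf.2 e he hce
    refine hcf (hf1 ⟨hc1.1, fun e' he' hce' => ?_⟩)
    have hN1 := h.deg c1 a b1 e' hc1.2.2.1 hc1.2.2.2.1 hce' hb1.1 (by rintro rfl; exact ha he')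
      (by rintro rfl; exact hb1.2.2.1 he')
    obtain ⟨s, t, hs, ht, hcs, hct, hst⟩ := T.nonmono c1 hc1.1 hr1
    have hk := hc1.2.2.2.2
    rcases hN1 s hcs with rfl | rfl | rfl <;> rcases hN1 t hct with rfl | rfl | rfl <;>
      simp_all
  refine ⟨hfar, ?_⟩
  obtain ⟨x', hx', hax', hxm'⟩ := h.exists_nonmulti ha
  rcases h.deg a x' c1 c2 hax' hc1.2.2.1.symm hc2.2.2.1.symm (by rintro rfl; exact hxm' hc1.1)
    (by rintro rfl; exact hxm' hc2.1) hc12 d had with rfl | rfl | rfl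
  · exact Or.inl fun hf => hxm' hf.1
  · exact Or.inr hρ1
  · exact Or.inr hρ2

/-- The broken layout of the link graph is rearranged block by block. Joined vertices are then
consecutive unless their pair is broken, which leaves broken links and far roots as the only sources
of vertices in between. -/
theorem IsSaturated.nonempty_thickOrder {V : Type*} [Finite V] {G : SimpleGraph V}
    {C : V → Prop} (h : IsSaturated G C) : Nonempty (ThickOrder G C) := by
  classical
  cases nonempty_fintype V
  obtain ⟨T⟩ := h.nonempty_thickColoring
  obtain ⟨L⟩ := exists_brokenLayout T.linkGraph T.weight
    (fun u a b c ha hb hc => h.linkGraph_deg T ha hb hc)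
  obtain ⟨B, hB⟩ : ∃ B : ℤ, ∀ v, -B ≤ L.p v ∧ L.p v ≤ B := by
    refine ⟨∑ v, |L.p v|, fun v => ?_⟩
    have := Finset.single_le_sum (f := fun v => |L.p v|) (fun _ _ => abs_nonneg _)
      (Finset.mem_univ v)
    exact abs_le.1 this
  -- Blocks occupy disjoint windows of length `2 * B + 1`; the final `B + 3` makes every value at
  -- least `3`.
  let q : V → ℤ := fun a => T.blk a * (2 * B + 1) + L.p a + B + 3
  have hq : ∀ a, q a = T.blk a * (2 * B + 1) + L.p a + B + 3 := fun a => rfl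
  have hblk : ∀ a b, q a ≤ q b → T.blk a ≤ T.blk b := by
    intro a b hab
    by_contra! hlt
    have h1 : (T.blk b : ℤ) + 1 ≤ T.blk a := by exact_mod_cast hlt
    have ha := hB a
    have hb := hB b
    rw [hq, hq] at hab
    nlinarith
  have hp : ∀ a b, T.blk a = T.blk b → (q a < q b ↔ L.p a < L.p b) := by
    intro a b hab
    rw [hq, hq, hab]
    constructor <;> intro h <;> linarith
  have hmid : ∀ a b c, q a < q b → q b < q c → T.blk a = T.blk c →
      T.blk b = T.blk a ∧ L.p a < L.p b ∧ L.p b < L.p c := by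
    intro a b c hab hbc hac
    have h1 := hblk _ _ hab.le
    have h2 := hblk _ _ hbc.le
    have h3 : T.blk b = T.blk a := by omega
    exact ⟨h3, (hp _ _ h3.symm).1 hab, (hp _ _ (h3.trans hac)).1 hbc⟩
  have hnear : ∀ a b c, L.p a < L.p b → L.p b < L.p c → T.linkGraph.Adj a c →
      L.Brk a c ∨ L.Brk c a := by
    intro a b c hab hbc hac
    refine (L.near_or_brk a c hac).resolve_left fun h => ?_
    rcases abs_eq (by norm_num : (0:ℤ) ≤ 1) |>.1 h with h | h <;> omega
  refine ⟨{ col := T.col, q := q, N := ∑ v, |q v| + 3, ρ := T.ρ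
            lower := ?_, upper := ?_, inj := ?_, adj_col := T.adj_col, noncross := ?_
            ρ_inj := fun c d hc hd => T.inj c d hc.1 hd.1, between := ?_ }⟩
  · intro a _
    have := hB a
    rw [hq]
    have h1 : (0 : ℤ) ≤ T.blk a := by positivity
    nlinarith
  · intro a _
    have := Finset.single_le_sum (f := fun v => |q v|) (fun _ _ => abs_nonneg _)
      (Finset.mem_univ a)
    have h2 := le_abs_self (q a)
    linarith
  · intro a b _ _ hab
    have h1 : T.blk a = T.blk b := le_antisymm (hblk _ _ hab.le) (hblk _ _ hab.ge)
    apply L.inj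
    rw [hq, hq, h1] at hab
    linarith
  · intro a a' b b' ha ha' hb hb' haa hbb h1 h2 h3
    obtain ⟨k1, k2, k3⟩ := hmid b' a b h1 h2 (T.adj_blk _ _ hb hb' hbb).symm
    obtain ⟨-, -, k5⟩ := hmid a b a' h2 h3 (T.adj_blk _ _ ha ha' haa)
    have haH : T.linkGraph.Adj a a' := ⟨haa.ne, ha, ha', Or.inl haa⟩
    have hbH : T.linkGraph.Adj b' b := ⟨hbb.ne.symm, hb', hb, Or.inl hbb.symm⟩
    -- Each of the crossing edges has an end of the other strictly inside, so both are broken, in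
    -- the same component, against the uniqueness of the broken edge.
    rcases hnear a b a' k3 k5 haH with hA | hA <;> rcases hnear b' a b k2 k3 hbH with hb | hb
    · have hr := L.brk_between _ _ hA b (Or.inl ⟨k3, k5⟩)
      have := (L.brk_unique _ _ _ _ hA hb (hr.trans hbH.symm.reachable)).1
      rw [this] at k2
      omega
    · have hr := L.brk_between _ _ hA b (Or.inl ⟨k3, k5⟩)
      have := (L.brk_unique _ _ _ _ hA hb hr).1
      rw [this] at k3
      omega
    · have hr := L.brk_between _ _ hA b (Or.inr ⟨k3, k5⟩)
      have := (L.brk_unique _ _ _ _ hA hb (hr.trans hbH.symm.reachable)).1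
      rw [this] at k5
      omega
    · have hr := L.brk_between _ _ hA b (Or.inr ⟨k3, k5⟩)
      have := (L.brk_unique _ _ _ _ hA hb hr).1
      rw [this] at k5
      omega
  · intro c u v a hc hu hv ha hcu hcv hcol h1 h2 d hd had
    have huv : u ≠ v := by rintro rfl; omega
    have hau : a ≠ u := by rintro rfl; omega
    have hav : a ≠ v := by rintro rfl; omega
    have hcm : IsMulti G C c := ⟨hc, u, v, huv, hu, hv, hcu, hcv⟩
    have hbu := T.multi_blk c u hcm hu hcu
    have hbv := T.multi_blk c v hcm hv hcv
    obtain ⟨k1, k2, k3⟩ := hmid u a v h1 h2 (hbu.symm.trans hbv)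
    -- A far root links nothing, but it precedes every other `IsMulti` vertex of its block, which
    -- settles all vertices lying in that block.
    by_cases hfree : T.root c ∧ IsFar G C c
    · by_cases hdc : d = c
      · exact Or.inl hdc
      refine Or.inr ⟨hfree.2, ?_⟩
      by_cases hdm : IsMulti G C d
      · have := T.multi_blk d a hdm ha had.symm
        exact Or.inr (T.of_root c d hcm hdm hfree.1 hdc (this.trans (k1.trans hbu.symm))).2.2
      · exact Or.inl fun hf => hdm hf.1
    · right
      have hl : T.Link c u v := ⟨hcm, hfree, hcu, hcv, hcol⟩
      rcases hnear u a v k2 k3 ⟨huv, hu, hv, Or.inr ⟨c, hl⟩⟩ with hb | hb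
      · exact h.after_of_broken T L hl hb ha (L.brk_between _ _ hb a (Or.inl ⟨k2, k3⟩)) hau hav had
      · exact h.after_of_broken T L hl.symm hb ha (L.brk_between _ _ hb a (Or.inr ⟨k2, k3⟩)) hav
          hau had

/-! ### First coordinates of the thin boxes -/

/-- First coordinates of the boxes of the vertices of `C`: vertices isolated in `C` with two
neighbours outside are placed far left, the paths of `C` become chains of touching intervals, and
in each cycle of `C` one vertex is stretched. -/
structure ThinLayout {V : Type*} (G : SimpleGraph V) (C : V → Prop) (ρ pri : V → ℕ) where
  l : V → ℤ
  r : V → ℤ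
  Brk : V → V → Prop
  lt : ∀ c, l c < r c
  brk_adj : ∀ s b, Brk s b → (graphOn G C).Adj s b
  brk_two : ∀ s b, Brk s b → ∀ t, (graphOn G C).Reachable s t →
    ∃ x y, x ≠ y ∧ (graphOn G C).Adj t x ∧ (graphOn G C).Adj t y
  brk_min : ∀ s b, Brk s b → ∀ t, (graphOn G C).Reachable s t → pri s ≤ pri t
  brk_unique : ∀ s b s' b', Brk s b → Brk s' b' → (graphOn G C).Reachable s s' → s = s' ∧ b = b'
  touch : ∀ c d, C c → C d → (∀ x, ¬ Brk c x) → (∀ x, ¬ Brk d x) → G.Adj c d →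
    r c = l d ∨ r d = l c
  apart : ∀ c d, C c → C d → c ≠ d → (∀ x, ¬ Brk c x) → (∀ x, ¬ Brk d x) → ¬ G.Adj c d →
    r c < l d ∨ r d < l c
  brk_touch : ∀ s b, Brk s b → r s = l b ∨ r b = l s
  brk_overlap : ∀ s b o, Brk s b → (graphOn G C).Adj s o → l s ≤ r o ∧ l o ≤ r s
  brk_apart : ∀ s b t, Brk s b → C t → ¬ (graphOn G C).Reachable s t → r s < l t ∨ r t < l s
  far_lt : ∀ c d, IsFar G C c → (¬ IsFar G C d ∨ ρ c < ρ d) → r c < r d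

/-- A broken layout of the graph on `C` gives unit intervals `[p, p + 1]`, touching along edges. The
vertex `s` of a broken edge `s b` is stretched across the cycle until it touches the interval of
`b`. -/
theorem IsSaturated.nonempty_thinLayout {V : Type*} [Finite V] {G : SimpleGraph V}
    {C : V → Prop} (h : IsSaturated G C) (ρ pri : V → ℕ)
    (hρ : ∀ c d, IsFar G C c → IsFar G C d → ρ c = ρ d → c = d) :
    Nonempty (ThinLayout G C ρ pri) := by
  classical
  cases nonempty_fintype V
  set F := graphOn G C with hF
  obtain ⟨L⟩ := exists_brokenLayout F (fun u _ => pri u)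
    (fun u a b c ha hb hc => h.degC u a b c ha.1 ha.2.1 hb.2.1 hc.2.1 ha.2.2 hb.2.2 hc.2.2)
  obtain ⟨B, hB⟩ : ∃ B : ℤ, ∀ v, -B ≤ L.p v ∧ L.p v ≤ B := by
    refine ⟨∑ v, |L.p v|, fun v => ?_⟩
    have := Finset.single_le_sum (f := fun v => |L.p v|) (fun _ _ => abs_nonneg _)
      (Finset.mem_univ v)
    exact abs_le.1 this
  obtain ⟨K, hK⟩ : ∃ K : ℤ, ∀ v, 2 * (ρ v : ℤ) + B + 5 ≤ K := by
    refine ⟨2 * ∑ v, (ρ v : ℤ) + B + 5, fun v => ?_⟩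
    have := Finset.single_le_sum (f := fun v => (ρ v : ℤ)) (fun _ _ => by positivity)
      (Finset.mem_univ v)
    linarith
  -- The factor `2` leaves gaps between far vertices, and `K` puts them all to the left of `-B`.
  have hex : ∀ v, ∃ x : ℤ × ℤ, (IsFar G C v → x.1 = 2 * ρ v - K ∧ x.2 = 2 * ρ v - K + 1) ∧
      (¬ IsFar G C v → (∀ b, ¬ L.Brk v b) → x.1 = L.p v ∧ x.2 = L.p v + 1) ∧
      (∀ b, L.Brk v b → (L.p v + 2 ≤ L.p b ∧ x.1 = L.p v ∧ x.2 = L.p b) ∨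
        (L.p b + 2 ≤ L.p v ∧ x.1 = L.p b + 1 ∧ x.2 = L.p v + 1)) := by
    intro v
    by_cases hf : IsFar G C v
    · exact ⟨(_, _), fun _ => ⟨rfl, rfl⟩, fun h => absurd hf h, fun b hb =>
        absurd (L.brk_adj v b hb).2.2 (hf.2 b (L.brk_adj v b hb).2.1)⟩
    by_cases hb : ∃ b, L.Brk v b
    · obtain ⟨b, hb⟩ := hb
      have hu : ∀ b', L.Brk v b' → b' = b := fun b' hb' =>
        (L.brk_unique _ _ _ _ hb' hb (SimpleGraph.Reachable.refl _)).2
      have h1 := L.brk_not_near v b hb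
      have h2 : L.p v ≠ L.p b := fun h => (L.brk_adj v b hb).ne (L.inj h)
      rw [Ne, abs_eq (by norm_num)] at h1
      rcases lt_or_gt_of_ne h2 with h3 | h3
      · refine ⟨(L.p v, L.p b), fun h => absurd h hf, fun _ h => absurd hb (h b), ?_⟩
        intro b' hb'
        obtain rfl := hu b' hb'
        left
        simp only [and_true]
        omega
      · refine ⟨(L.p b + 1, L.p v + 1), fun h => absurd h hf, fun _ h => absurd hb (h b), ?_⟩
        intro b' hb'
        obtain rfl := hu b' hb'
        right
        simp only [and_true]
        omega
    · push Not at hb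
      exact ⟨(_, _), fun h => absurd h hf, fun _ _ => ⟨rfl, rfl⟩, fun b h => absurd h (hb b)⟩
  choose x hfar hnon hbrk using hex
  have hnf : ∀ u w, F.Adj u w → ¬ IsFar G C u := fun u w huw hf => hf.2 w huw.2.1 huw.2.2
  have hunb : ∀ u w, L.Brk u w → ∀ y, ¬ L.Brk w y := fun u w hw y hy =>
    (L.brk_adj u w hw).ne
      (L.brk_unique _ _ _ _ hw hy (L.brk_adj u w hw).reachable).1
  have hnear : ∀ u w, F.Adj u w → (∀ y, ¬ L.Brk u y) → (∀ y, ¬ L.Brk w y) →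
      L.p u = L.p w + 1 ∨ L.p w = L.p u + 1 := by
    intro u w huw hu hw
    have := (L.near_or_brk u w huw).resolve_right (fun h => h.elim (hu w) (hw u))
    rcases abs_eq (by norm_num : (0:ℤ) ≤ 1) |>.1 this with h | h <;> omega
  have hadj : ∀ u w, (L.p u = L.p w + 1 ∨ L.p w = L.p u + 1) → F.Adj u w := by
    intro u w huw
    refine L.adj_of_near u w ((abs_eq (by norm_num)).2 ?_)
    omega
  have hpe : ∀ u w, L.p u = L.p w → u = w := fun u w h => L.inj h
  have hlow : ∀ v, ¬ IsFar G C v → -B ≤ (x v).1 ∧ -B < (x v).2 := by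
    intro v hv
    have h1 := hB v
    by_cases hb : ∃ b, L.Brk v b
    · obtain ⟨b, hb⟩ := hb
      have h2 := hB b
      have h3 := hbrk v b hb
      omega
    · push Not at hb
      have h3 := hnon v hv hb
      omega
  have hhigh : ∀ v, IsFar G C v → (x v).2 < -B := by
    intro v hv
    have h1 := hK v
    have h2 := hfar v hv
    omega
  have hout : ∀ s b, L.Brk s b → ∀ t, ¬ F.Reachable s t →
      ¬ (L.p s < L.p t ∧ L.p t < L.p b ∨ L.p b < L.p t ∧ L.p t < L.p s) ∧
      L.p t ≠ L.p s ∧ L.p t ≠ L.p b ∧ L.p t ≠ L.p s + 1 ∧ L.p s ≠ L.p t + 1 ∧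
      L.p t ≠ L.p b + 1 ∧ L.p b ≠ L.p t + 1 := by
    intro s b hb t ht
    have hsb := (L.brk_adj s b hb).reachable
    refine ⟨fun h => ht (L.brk_between s b hb t h), fun h => ht ?_, fun h => ht ?_, fun h => ht ?_,
      fun h => ht ?_, fun h => ht ?_, fun h => ht ?_⟩
    · rw [hpe _ _ h]
    · rw [hpe _ _ h]
      exact hsb
    · exact (hadj s t (Or.inr h)).reachable
    · exact (hadj s t (Or.inl h)).reachable
    · exact hsb.trans (hadj b t (Or.inr h)).reachable
    · exact hsb.trans (hadj b t (Or.inl h)).reachable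
  refine ⟨{ l := fun v => (x v).1, r := fun v => (x v).2, Brk := L.Brk, brk_adj := L.brk_adj
            brk_two := L.brk_two, brk_unique := L.brk_unique
            lt := ?_, brk_min := ?_, touch := ?_, apart := ?_, brk_touch := ?_
            brk_overlap := ?_, brk_apart := ?_, far_lt := ?_ }⟩
  · intro c
    by_cases hf : IsFar G C c
    · have := hfar c hf
      omega
    · by_cases hb : ∃ b, L.Brk c b
      · obtain ⟨b, hb⟩ := hb
        have h3 := hbrk c b hb
        omega
      · push Not at hb
        have h3 := hnon c hf hb
        omega
  · intro s b hb t ht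
    obtain ⟨y, -, -, hy, -⟩ := L.brk_two s b hb t ht
    exact L.brk_min s b hb t y ht hy
  · intro c d hc hd hbc hbd hcd
    have hcd' : F.Adj c d := ⟨hc, hd, hcd⟩
    have h1 := hnon c (hnf _ _ hcd') hbc
    have h2 := hnon d (hnf _ _ hcd'.symm) hbd
    have h3 := hnear c d hcd' hbc hbd
    omega
  · intro c d hc hd hne hbc hbd hcd
    by_cases hfc : IsFar G C c <;> by_cases hfd : IsFar G C d
    · have h1 := hfar c hfc
      have h2 := hfar d hfd
      have h3 := mt (hρ c d hfc hfd) hne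
      omega
    · have h1 := hhigh c hfc
      have h2 := hlow d hfd
      omega
    · have h1 := hhigh d hfd
      have h2 := hlow c hfc
      omega
    · have h1 := hnon c hfc hbc
      have h2 := hnon d hfd hbd
      have h3 := mt (hadj c d) (fun h => hcd h.2.2)
      have h4 := mt (hpe c d) hne
      omega
  · intro s b hb
    have hsb := L.brk_adj s b hb
    have h1 := hnon b (hnf _ _ hsb.symm) (hunb s b hb)
    have h2 := hbrk s b hb
    omega
  · intro s b o hb hso
    have hsb := L.brk_adj s b hb
    have hbo : ∀ y, ¬ L.Brk o y := fun y hy =>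
      hso.ne (L.brk_unique _ _ _ _ hb hy hso.reachable).1
    have h1 := hnon o (hnf _ _ hso.symm) hbo
    have h2 := hbrk s b hb
    by_cases hob : o = b
    · subst hob
      omega
    · have := (L.near_or_brk s o hso).resolve_right (fun h => h.elim
        (fun h => hob (L.brk_unique _ _ _ _ h hb (SimpleGraph.Reachable.refl _)).2) (hbo s))
      rw [abs_eq (by norm_num)] at this
      omega
  · intro s b t hb ht hst
    have h1 := hbrk s b hb
    by_cases hft : IsFar G C t
    · have h2 := hhigh t hft
      have h3 := hlow s (hnf _ _ (L.brk_adj s b hb))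
      omega
    have h2 := hout s b hb t hst
    by_cases hbt : ∃ y, L.Brk t y
    · obtain ⟨y, hy⟩ := hbt
      have hty := (L.brk_adj t y hy).reachable
      have h3 := hout s b hb y (fun h => hst (h.trans hty.symm))
      have h4 := hout t y hy s (fun h => hst h.symm)
      have h5 := hbrk t y hy
      omega
    · push Not at hbt
      have h3 := hnon t hft hbt
      omega
  · intro c d hc hd
    by_cases hfd : IsFar G C d
    · have h1 := hfar c hc
      have h2 := hfar d hfd
      have h3 := hd.resolve_left (not_not.2 hfd)
      omega
    · have h1 := hhigh c hc
      have h2 := hlow d hfd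
      omega

/-! ### Second and third coordinates of the thin boxes -/

theorem exists_max_or {α V : Type*} [LinearOrder α] [Finite V] (base : α) (S : V → Prop)
    (f : V → α) : ∃ m, base ≤ m ∧ (∀ v, S v → f v ≤ m) ∧ (m = base ∨ ∃ v, S v ∧ m = f v) := by
  classical
  cases nonempty_fintype V
  let T : Finset α := insert base ((Finset.univ.filter S).image f)
  have hT : T.Nonempty := ⟨base, Finset.mem_insert_self _ _⟩
  refine ⟨T.max' hT, T.le_max' _ (Finset.mem_insert_self _ _), fun v hv => T.le_max' _ ?_, ?_⟩
  · exact Finset.mem_insert_of_mem (Finset.mem_image_of_mem _ (by simp [hv]))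
  · rcases Finset.mem_insert.1 (T.max'_mem hT) with h | h
    · exact Or.inl h
    · obtain ⟨v, hv, hv'⟩ := Finset.mem_image.1 h
      exact Or.inr ⟨v, by simpa using hv, hv'.symm⟩

/-- Two intervals `[-e v false, e v true]` and `[-e w false, e w true]` meet. -/
def Ov {V : Type*} (e : V → Bool → ℝ) (v w : V) : Prop := ∀ σ, 0 ≤ e v σ + e w (!σ)

/-- An end of one interval is an opposite end of the other. -/
def Tch {V : Type*} (e : V → Bool → ℝ) (v w : V) : Prop := ∃ σ, e v σ + e w (!σ) = 0

theorem ov_comm {V : Type*} {e : V → Bool → ℝ} {v w : V} : Ov e v w ↔ Ov e w v := by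
  constructor <;> intro h σ <;> have := h (!σ) <;> rw [Bool.not_not] at this <;> linarith

theorem tch_comm {V : Type*} {e : V → Bool → ℝ} {v w : V} : Tch e v w ↔ Tch e w v := by
  constructor <;> rintro ⟨σ, h⟩ <;> refine ⟨!σ, ?_⟩ <;> rw [Bool.not_not] <;> linarith

theorem ov_of {V : Type*} {e : V → Bool → ℝ} {v w : V} (σ : Bool) (h1 : 0 ≤ e v σ + e w (!σ))
    (h2 : 0 ≤ e v (!σ) + e w σ) : Ov e v w := by
  intro τ
  by_cases hτ : τ = σ
  · rw [hτ]
    exact h1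
  · rw [Bool.eq_not_of_ne hτ, Bool.not_not]
    exact h2

/-- `a` lies strictly between two equally coloured neighbours of `t`. -/
def ThickOrder.Mid {V : Type*} {G : SimpleGraph V} {C : V → Prop} (O : ThickOrder G C)
    (t a : V) : Prop :=
  ∃ u v, ¬ C u ∧ ¬ C v ∧ G.Adj t u ∧ G.Adj t v ∧ O.col u = O.col v ∧ O.q u < O.q a ∧ O.q a < O.q v

/-- Second and third coordinates of the boxes of the vertices of `C`. -/
structure ThinExtents {V : Type*} {G : SimpleGraph V} {C : V → Prop} (O : ThickOrder G C) where
  pri : V → ℕ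
  X : ThinLayout G C O.ρ pri
  y : V → Bool → ℝ
  z : V → Bool → ℝ
  pos_y : ∀ t σ, 0 < y t σ + y t (!σ)
  pos_z : ∀ t σ, 0 < z t σ + z t (!σ)
  avoid : ∀ t a, C t → ¬ C a → ¬ G.Adj t a →
    y t (O.col a) < O.q a ∨ z t (O.col a) < O.N - O.q a ∨ O.Mid t a
  meet : ∀ t a, C t → ¬ C a → G.Adj t a →
    O.q a ≤ y t (O.col a) ∧ O.N - O.q a ≤ z t (O.col a) ∧
    -(O.q a + 1 / 2) ≤ y t (!O.col a) ∧ -(O.N - O.q a + 1 / 2) ≤ z t (!O.col a)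
  corner : ∀ t a, C t → ¬ C a → G.Adj t a →
    y t (O.col a) = O.q a ∨ z t (O.col a) = O.N - O.q a ∨ O.Mid t a
  ov_plain : ∀ t t', C t → C t' → G.Adj t t' → (∀ x, ¬ X.Brk t x) → (∀ x, ¬ X.Brk t' x) →
    Ov y t t' ∧ Ov z t t'
  ov_brk : ∀ s b, X.Brk s b → Ov y s b ∧ Ov z s b
  ov_other : ∀ s b o, X.Brk s b → C o → G.Adj s o → o ≠ b →
    Ov y s o ∧ Ov z s o ∧ (Tch y s o ∨ Tch z s o)
  apart : ∀ s b t, X.Brk s b → (graphOn G C).Reachable s t → t ≠ s → ¬ G.Adj s t →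
    ¬ Ov y s t ∨ ¬ Ov z s t

/-- Thus a vertex on a cycle of `C` has at most one neighbour outside, so only one of its two colour
directions is constrained by thick boxes. The other is free for separating the stretched vertex. -/
theorem IsSaturated.eq_of_thick_adj {V : Type*} {G : SimpleGraph V} {C : V → Prop}
    (h : IsSaturated G C) {t x y a b : V} (hxy : x ≠ y) (hx : (graphOn G C).Adj t x)
    (hy : (graphOn G C).Adj t y) (ha : ¬ C a) (hb : ¬ C b) (hta : G.Adj t a) (htb : G.Adj t b) :
    a = b := by
  rcases h.deg t x y a hx.2.2 hy.2.2 hta hxy (by rintro rfl; exact ha hx.2.1)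
    (by rintro rfl; exact ha hy.2.1) b htb with rfl | rfl | rfl
  · exact absurd hx.2.1 hb
  · exact absurd hy.2.1 hb
  · rfl

/-- Off the cycles the extents are the farthest coordinates of thick neighbours, per colour. On a
cycle, let `s` be the stretched vertex and read distances in its direction `sg s`. The box of `s`
starts at `1/2` in the second coordinate and ends at `Z s` in the third. A vertex of the other
direction stops at `1/2` if it must touch `s` and at `0` if it must miss it; one of the same
direction starts at `Z s`, respectively `Z s + 1/2`, in the third coordinate. The partner `b` only
has to overlap there, as it touches `s` in the first coordinate. -/
theorem IsSaturated.nonempty_thinExtents {V : Type*} [Finite V] {G : SimpleGraph V}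
    {C : V → Prop} (h : IsSaturated G C) (O : ThickOrder G C) : Nonempty (ThinExtents O) := by
  classical
  -- The default `1` keeps the origin inside, yet stays below every thick corner, whose coordinates
  -- are at least `3` in absolute value.
  have hY : ∀ (f : V → ℤ) (t : V) (σ : Bool), ∃ m : ℤ, 1 ≤ m ∧
      (∀ a, (¬ C a ∧ G.Adj t a ∧ O.col a = σ) → f a ≤ m) ∧
      (m = 1 ∨ ∃ a, (¬ C a ∧ G.Adj t a ∧ O.col a = σ) ∧ m = f a) := fun f t σ =>
    exists_max_or 1 _ f
  choose E hE1 hEle hEor using hY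
  let Y := E O.q
  let Z := E (fun a => O.N - O.q a)
  have hsg : ∀ t, ∃ σ : Bool, (∃ a, ¬ C a ∧ G.Adj t a) → ∃ a, ¬ C a ∧ G.Adj t a ∧ O.col a = σ := by
    intro t
    by_cases hex : ∃ a, ¬ C a ∧ G.Adj t a
    · obtain ⟨a, h1, h2⟩ := hex
      exact ⟨O.col a, fun _ => ⟨a, h1, h2, rfl⟩⟩
    · exact ⟨true, fun h => absurd h hex⟩
  choose sg hsg using hsg
  obtain ⟨X⟩ := h.nonempty_thinLayout O.ρ (fun t => (Z t (sg t)).toNat) O.ρ_inj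
  set F := graphOn G C with hF
  -- Spelled-out extents in the components of `C` that are cycles.
  let Spec : V → V → V → (Bool → ℝ) → (Bool → ℝ) → Prop := fun s b t y z =>
    (t = s → y (sg s) = Y s (sg s) ∧ y (!sg s) = -(1 / 2) ∧ ∀ τ, z τ = Z s τ) ∧
    (t ≠ s → z (sg s) = max (Z t (sg s) : ℝ) (Z s (sg s) + 3 / 4) ∧
      (sg t = sg s → (∀ τ, y τ = Y t τ) ∧ z (!sg s) = if t = b then (Z t (!sg s) : ℝ) else
        if G.Adj s t then -(Z s (sg s) : ℝ) else -(Z s (sg s) + 1 / 2)) ∧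
      (sg t ≠ sg s → y (!sg s) = Y t (!sg s) ∧
        y (sg s) = (if t = b then 1 else if G.Adj s t then 1 / 2 else 0) ∧
        z (!sg s) = Z t (!sg s)))
  have hex : ∀ t, ∃ yz : (Bool → ℝ) × (Bool → ℝ),
      ((∀ s b, X.Brk s b → ¬ F.Reachable s t) → ∀ τ, yz.1 τ = Y t τ ∧ yz.2 τ = Z t τ) ∧
      ∀ s b, X.Brk s b → F.Reachable s t → Spec s b t yz.1 yz.2 := by
    intro t
    by_cases hbr : ∃ s b, X.Brk s b ∧ F.Reachable s t
    swap
    · push Not at hbr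
      exact ⟨(fun τ => Y t τ, fun τ => Z t τ), fun _ _ => ⟨rfl, rfl⟩,
        fun s b h1 h2 => absurd h2 (hbr s b h1)⟩
    obtain ⟨s, b, hsb, hst⟩ := hbr
    suffices hs : ∃ y z, Spec s b t y z by
      obtain ⟨y, z, hs⟩ := hs
      refine ⟨(y, z), fun h => absurd hst (h s b hsb), fun s' b' hsb' hst' => ?_⟩
      obtain ⟨rfl, rfl⟩ := X.brk_unique s b s' b' hsb hsb' (hst.trans hst'.symm)
      exact hs
    by_cases hts : t = s
    · refine ⟨fun τ => if τ = sg s then Y s (sg s) else -(1 / 2), fun τ => Z s τ,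
        fun _ => ⟨by simp, by simp, fun _ => rfl⟩, fun h => absurd hts h⟩
    by_cases hsg : sg t = sg s
    · exact ⟨fun τ => Y t τ, fun τ => if τ = sg s then max (Z t (sg s) : ℝ) (Z s (sg s) + 3 / 4)
        else if t = b then (Z t (!sg s) : ℝ) else
        if G.Adj s t then -(Z s (sg s) : ℝ) else -(Z s (sg s) + 1 / 2),
        fun h => absurd h hts, fun _ => ⟨by simp, fun _ => ⟨fun _ => rfl, by simp⟩,
        fun h => absurd hsg h⟩⟩
    · exact ⟨fun τ => if τ = sg s then (if t = b then 1 else if G.Adj s t then 1 / 2 else 0) else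
        Y t (!sg s), fun τ => if τ = sg s then max (Z t (sg s) : ℝ) (Z s (sg s) + 3 / 4)
        else Z t (!sg s),
        fun h => absurd h hts, fun _ => ⟨by simp, fun h => absurd h hsg,
        fun _ => ⟨by simp, by simp, by simp⟩⟩⟩
  choose yz hplain hspec using hex
  have hY1 : ∀ t τ, (1 : ℝ) ≤ Y t τ := fun t τ => by exact_mod_cast hE1 _ t τ
  have hZ1 : ∀ t τ, (1 : ℝ) ≤ Z t τ := fun t τ => by exact_mod_cast hE1 _ t τ
  have hYa : ∀ t a, ¬ C a → G.Adj t a → O.q a ≤ Y t (O.col a) :=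
    fun t a ha hta => hEle _ t _ a ⟨ha, hta, rfl⟩
  have hZa : ∀ t a, ¬ C a → G.Adj t a → O.N - O.q a ≤ Z t (O.col a) :=
    fun t a ha hta => hEle _ t _ a ⟨ha, hta, rfl⟩
  have hYo : ∀ t τ, Y t τ = 1 ∨ ∃ a, (¬ C a ∧ G.Adj t a ∧ O.col a = τ) ∧ Y t τ = O.q a :=
    fun t τ => hEor _ t τ
  have hZo : ∀ t τ, Z t τ = 1 ∨ ∃ a, (¬ C a ∧ G.Adj t a ∧ O.col a = τ) ∧ Z t τ = O.N - O.q a :=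
    fun t τ => hEor _ t τ
  have hone : ∀ s b t, X.Brk s b → F.Reachable s t → ∀ a, ¬ C a → G.Adj t a →
      O.col a = sg t ∧ ∀ a', ¬ C a' → G.Adj t a' → a' = a := by
    intro s b t hb hst a ha hta
    obtain ⟨x, y, hxy, hx, hy⟩ := X.brk_two s b hb t hst
    have hu : ∀ a', ¬ C a' → G.Adj t a' → a' = a := fun a' ha' hta' =>
      h.eq_of_thick_adj hxy hx hy ha' ha hta' hta
    obtain ⟨a', h1, h2, h3⟩ := hsg t ⟨a, ha, hta⟩
    rw [hu a' h1 h2] at h3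
    exact ⟨h3, hu⟩
  -- This is why `s` minimizes the priority: starting the third coordinate of `t` as late as `Z s +
  -- 1/2` is at most `1/2` past the corner of its thick neighbour, a margin every thick box has.
  have hmin : ∀ s b t, X.Brk s b → F.Reachable s t → sg t = sg s →
      (Z s (sg s) : ℝ) ≤ Z t (sg s) := by
    intro s b t hb hst hts
    have h1 := X.brk_min s b hb t hst
    have h2 : 1 ≤ Z t (sg s) := by exact_mod_cast hZ1 t (sg s)
    rw [hts] at h1
    have h3 : Z s (sg s) ≤ Z t (sg s) := by omega
    exact_mod_cast h3
  clear_value Y Z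
  have hnot : ∀ σ τ : Bool, τ ≠ σ → τ = !σ := by decide
  have hcyc : ∀ s b t, X.Brk s b → F.Reachable s t →
      (∀ τ, (yz t).1 τ ≤ Y t τ) ∧ (yz t).1 (sg t) = Y t (sg t) ∧
      Z t (sg t) ≤ (yz t).2 (sg t) ∧ (yz t).2 (sg t) ≤ Z t (sg t) + 3 / 4 ∧
      -(1 / 2) ≤ (yz t).1 (!sg t) ∧ -(Z t (sg t) + 1 / 2) ≤ (yz t).2 (!sg t) ∧
      0 < (yz t).2 (sg t) + (yz t).2 (!sg t) := by
    intro s b t hb hst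
    obtain ⟨hs1, hs2⟩ := hspec t s b hb hst
    have hZs := hZ1 s (sg s)
    have hZs' := hZ1 s (!sg s)
    have hZt := hZ1 t (sg s)
    have hZt' := hZ1 t (!sg s)
    have hYt := hY1 t (sg s)
    have hYt' := hY1 t (!sg s)
    by_cases hts : t = s
    · obtain ⟨h1, h2, h3⟩ := hs1 hts
      subst hts
      refine ⟨fun τ => ?_, h1, (h3 _).ge, by rw [h3]; linarith, h2.ge, by rw [h3]; linarith,
        by rw [h3, h3]; linarith⟩
      by_cases hτ : τ = sg t
      · rw [hτ, h1]
      · rw [hnot _ _ hτ, h2]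
        linarith
    obtain ⟨h1, h2, h3⟩ := hs2 hts
    by_cases hsg : sg t = sg s
    · obtain ⟨h4, h5⟩ := h2 hsg
      have hm := hmin s b t hb hst hsg
      have hz : -(Z s (sg s) + 1 / 2) ≤ (yz t).2 (!sg s) := by
        rw [h5]
        split_ifs <;> linarith
      have hm1 := le_max_left (Z t (sg s) : ℝ) (Z s (sg s) + 3 / 4)
      have hm2 := le_max_right (Z t (sg s) : ℝ) (Z s (sg s) + 3 / 4)
      have hm3 : max (Z t (sg s) : ℝ) (Z s (sg s) + 3 / 4) ≤ Z t (sg s) + 3 / 4 :=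
        max_le (by linarith) (by linarith)
      rw [hsg]
      refine ⟨fun τ => (h4 τ).le, h4 _, by rw [h1]; exact hm1, by rw [h1]; exact hm3,
        by rw [h4]; linarith, by linarith, by rw [h1]; linarith⟩
    · obtain ⟨h4, h5, h6⟩ := h3 hsg
      have hsg' := hnot _ _ hsg
      have hm1 := le_max_left (Z t (sg s) : ℝ) (Z s (sg s) + 3 / 4)
      have hy : (yz t).1 (sg s) ≤ 1 ∧ 0 ≤ (yz t).1 (sg s) := by
        rw [h5]
        split_ifs <;> norm_num
      rw [hsg', Bool.not_not]
      refine ⟨fun τ => ?_, h4, h6.ge, by rw [h6]; linarith, by linarith, by rw [h1]; linarith,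
        by rw [h6, h1]; linarith⟩
      by_cases hτ : τ = sg s
      · rw [hτ]
        linarith
      · rw [hnot _ _ hτ, h4]
  have hcase : ∀ t, (∃ s b, X.Brk s b ∧ F.Reachable s t) ∨
      ∀ τ, (yz t).1 τ = Y t τ ∧ (yz t).2 τ = Z t τ := by
    intro t
    by_cases hbr : ∃ s b, X.Brk s b ∧ F.Reachable s t
    · exact Or.inl hbr
    · push Not at hbr
      exact Or.inr (hplain t hbr)
  have hpos : ∀ (f : Bool → ℝ) (σ : Bool), 0 < f σ + f (!σ) → ∀ τ, 0 < f τ + f (!τ) := by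
    intro f σ hf τ
    by_cases hτ : τ = σ
    · rw [hτ]
      exact hf
    · rw [hnot _ _ hτ, Bool.not_not]
      linarith
  refine ⟨{ pri := _, X := X, y := fun t => (yz t).1, z := fun t => (yz t).2
            pos_y := ?_, pos_z := ?_, avoid := ?_, meet := ?_, corner := ?_
            ov_plain := ?_, ov_brk := ?_, ov_other := ?_, apart := ?_ }⟩
  · intro t
    rcases hcase t with ⟨s, b, hb, hst⟩ | hn
    · obtain ⟨-, h2, -, -, h3, -⟩ := hcyc s b t hb hst
      refine hpos _ (sg t) ?_
      have := hY1 t (sg t)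
      linarith
    · refine hpos _ true ?_
      have h1 := hY1 t true
      have h2 := hY1 t (!true)
      rw [(hn _).1, (hn _).1]
      linarith
  · intro t
    rcases hcase t with ⟨s, b, hb, hst⟩ | hn
    · exact hpos _ (sg t) (hcyc s b t hb hst).2.2.2.2.2.2
    · refine hpos _ true ?_
      have h1 := hZ1 t true
      have h2 := hZ1 t (!true)
      rw [(hn _).2, (hn _).2]
      linarith
  · intro t a ht ha hta
    have hqa := O.lower a ha
    have hqa' := O.upper a ha
    rcases hcase t with ⟨s, b, hb, hst⟩ | hn
    · obtain ⟨h1, h2, h3, h4, -⟩ := hcyc s b t hb hst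
      rcases hYo t (O.col a) with hy | ⟨u, ⟨hu, htu, hcu⟩, hy⟩
      · left
        have := h1 (O.col a)
        rw [hy] at this
        have h5 : (3 : ℝ) ≤ O.q a := by exact_mod_cast hqa
        push_cast at this
        linarith
      · have hcol := (hone s b t hb hst u hu htu).1
        have hne : O.q u ≠ O.q a := fun heq => hta (O.inj u a hu ha heq ▸ htu)
        rcases lt_or_gt_of_ne hne with hlt | hlt
        · left
          have h5 : (O.q u : ℝ) < O.q a := by exact_mod_cast hlt
          have := h1 (O.col a)
          rw [hy] at this
          linarith
        · right; left
          have h5 : (O.q a : ℝ) + 1 ≤ O.q u := by exact_mod_cast hlt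
          rcases hZo t (O.col a) with hz | ⟨u', ⟨hu', htu', hcu'⟩, hz⟩
          · rw [← hcu, hcol] at hz ⊢
            rw [hz] at h4
            have h6 : (O.q a : ℝ) + 3 ≤ O.N := by exact_mod_cast hqa'
            push_cast at h4
            linarith
          · obtain rfl := (hone s b t hb hst u hu htu).2 u' hu' htu'
            rw [← hcu, hcol] at hz ⊢
            rw [hz] at h4
            push_cast at h4
            linarith
    · rw [(hn _).1, (hn _).2]
      -- Off the cycles the extents are attained by neighbours, so a corner inside both of them lies
      -- between two neighbours of its colour.
      by_contra! hcon
      obtain ⟨h1, h2, h3⟩ := hcon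
      have h1' : O.q a ≤ Y t (O.col a) := by exact_mod_cast h1
      have h2' : O.N - O.q a ≤ Z t (O.col a) := by exact_mod_cast h2
      obtain ⟨v, ⟨hv, htv, hcv⟩, hy⟩ := (hYo t (O.col a)).resolve_left (by omega)
      obtain ⟨u, ⟨hu, htu, hcu⟩, hz⟩ := (hZo t (O.col a)).resolve_left (by omega)
      have hnv : O.q v ≠ O.q a := fun heq => hta (O.inj v a hv ha heq ▸ htv)
      have hnu : O.q u ≠ O.q a := fun heq => hta (O.inj u a hu ha heq ▸ htu)
      exact h3 ⟨u, v, hu, hv, htu, htv, hcu.trans hcv.symm, by omega, by omega⟩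
  · intro t a ht ha hta
    have hqa : (3 : ℝ) ≤ O.q a := by exact_mod_cast O.lower a ha
    have hqa' : (O.q a : ℝ) + 3 ≤ O.N := by exact_mod_cast O.upper a ha
    have hy := hYa t a ha hta
    have hz := hZa t a ha hta
    have hy' : (O.q a : ℝ) ≤ Y t (O.col a) := by exact_mod_cast hy
    have hz' : (O.N : ℝ) - O.q a ≤ Z t (O.col a) := by exact_mod_cast hz
    rcases hcase t with ⟨s, b, hb, hst⟩ | hn
    · obtain ⟨-, h2, h3, h4, h5, h6, -⟩ := hcyc s b t hb hst
      obtain ⟨hcol, hu⟩ := hone s b t hb hst a ha hta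
      rw [hcol] at hy' hz' ⊢
      refine ⟨by linarith, by linarith, by linarith, ?_⟩
      rcases hZo t (sg t) with hz1 | ⟨u', ⟨hu', htu', hcu'⟩, hz1⟩
      · rw [hz1] at h6
        push_cast at h6
        linarith
      · obtain rfl := hu u' hu' htu'
        rw [hz1] at h6
        push_cast at h6
        linarith
    · rw [(hn _).1, (hn _).1, (hn _).2, (hn _).2]
      have h1 := hY1 t (!O.col a)
      have h2 := hZ1 t (!O.col a)
      exact ⟨hy', hz', by linarith, by linarith⟩
  · intro t a ht ha hta
    have hqa := O.lower a ha
    have hqa' := O.upper a ha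
    have hy := hYa t a ha hta
    have hz := hZa t a ha hta
    obtain ⟨v, ⟨hv, htv, hcv⟩, hyv⟩ := (hYo t (O.col a)).resolve_left (by omega)
    obtain ⟨u, ⟨hu, htu, hcu⟩, hzu⟩ := (hZo t (O.col a)).resolve_left (by omega)
    rcases hcase t with ⟨s, b, hb, hst⟩ | hn
    · obtain ⟨-, h2, -⟩ := hcyc s b t hb hst
      obtain ⟨hcol, hu⟩ := hone s b t hb hst a ha hta
      obtain rfl := hu v hv htv
      left
      rw [← hyv, hcol, h2]
    · rw [(hn _).1, (hn _).2]
      by_contra! hcon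
      obtain ⟨h1, h2, h3⟩ := hcon
      have h1' : Y t (O.col a) ≠ O.q a := by exact_mod_cast h1
      have h2' : Z t (O.col a) ≠ O.N - O.q a := by exact_mod_cast h2
      exact h3 ⟨u, v, hu, hv, htu, htv, hcu.trans hcv.symm, by omega, by omega⟩
  · intro t t' ht ht' hadj hbt hbt'
    have hF' : F.Adj t t' := ⟨ht, ht', hadj⟩
    by_cases hbr : ∃ s b, X.Brk s b ∧ F.Reachable s t
    · obtain ⟨s, b, hb, hst⟩ := hbr
      -- All vertices of the cycle except `s` share the points with second coordinate `0` and third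
      -- coordinate between `Z s + 1/2` and `Z s + 3/4` in direction `sg s`.
      have key : ∀ t, F.Reachable s t → (∀ x, ¬ X.Brk t x) →
          0 ≤ (yz t).1 (sg s) ∧ 0 ≤ (yz t).1 (!sg s) ∧ Z s (sg s) + 3 / 4 ≤ (yz t).2 (sg s) ∧
          -(Z s (sg s) + 1 / 2) ≤ (yz t).2 (!sg s) := by
        intro t hst hbt
        obtain ⟨-, hs2⟩ := hspec t s b hb hst
        obtain ⟨h1, h2, h3⟩ := hs2 (by rintro rfl; exact hbt b hb)
        have hZs := hZ1 s (sg s)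
        have hZt' := hZ1 t (!sg s)
        have hYt := hY1 t (sg s)
        have hYt' := hY1 t (!sg s)
        rw [h1]
        have hm2 := le_max_right (Z t (sg s) : ℝ) (Z s (sg s) + 3 / 4)
        by_cases hsg : sg t = sg s
        · obtain ⟨h4, h5⟩ := h2 hsg
          rw [h4, h4, h5]
          refine ⟨by linarith, by linarith, hm2, ?_⟩
          split_ifs <;> linarith
        · obtain ⟨h4, h5, h6⟩ := h3 hsg
          rw [h4, h5, h6]
          refine ⟨?_, by linarith, hm2, by linarith⟩
          split_ifs <;> norm_num
      obtain ⟨a1, a2, a3, a4⟩ := key t hst hbt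
      obtain ⟨b1, b2, b3, b4⟩ := key t' (hst.trans hF'.reachable) hbt'
      exact ⟨ov_of (sg s) (by linarith) (by linarith), ov_of (sg s) (by linarith) (by linarith)⟩
    · push Not at hbr
      have hn := hplain t hbr
      have hn' := hplain t' (fun s b hb hst => hbr s b hb (hst.trans hF'.symm.reachable))
      constructor <;> intro σ
      · have h1 := hY1 t σ
        have h2 := hY1 t' (!σ)
        beta_reduce
        rw [(hn _).1, (hn' _).1]
        linarith
      · have h1 := hZ1 t σ
        have h2 := hZ1 t' (!σ)
        beta_reduce
        rw [(hn _).2, (hn' _).2]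
        linarith
  · intro s b hb
    have hsb := X.brk_adj s b hb
    obtain ⟨h1, h2, h3⟩ := (hspec s s b hb (SimpleGraph.Reachable.refl _)).1 rfl
    obtain ⟨h4, h5, h6⟩ := (hspec b s b hb hsb.reachable).2 hsb.ne.symm
    have hZs := hZ1 s (sg s)
    have hZs' := hZ1 s (!sg s)
    have hZb' := hZ1 b (!sg s)
    have hYs := hY1 s (sg s)
    have hYb := hY1 b (sg s)
    have hYb' := hY1 b (!sg s)
    have hm2 := le_max_right (Z b (sg s) : ℝ) (Z s (sg s) + 3 / 4)
    by_cases hsg : sg b = sg s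
    · obtain ⟨h7, h8⟩ := h5 hsg
      rw [if_pos rfl] at h8
      refine ⟨ov_of (sg s) ?_ ?_, ov_of (sg s) ?_ ?_⟩
      · rw [h1, h7]
        linarith
      · rw [h2, h7]
        linarith
      · rw [h3, h8]
        linarith
      · rw [h3, h4]
        linarith
    · obtain ⟨h7, h8, h9⟩ := h6 hsg
      rw [if_pos rfl] at h8
      refine ⟨ov_of (sg s) ?_ ?_, ov_of (sg s) ?_ ?_⟩
      · rw [h1, h7]
        linarith
      · rw [h2, h8]
        norm_num
      · rw [h3, h9]
        linarith
      · rw [h3, h4]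
        linarith
  · intro s b o hb ho hso hob
    have hsb : F.Adj s o := ⟨(X.brk_adj s b hb).1, ho, hso⟩
    obtain ⟨h1, h2, h3⟩ := (hspec s s b hb (SimpleGraph.Reachable.refl _)).1 rfl
    obtain ⟨h4, h5, h6⟩ := (hspec o s b hb hsb.reachable).2 hsb.ne.symm
    have hZs := hZ1 s (sg s)
    have hZs' := hZ1 s (!sg s)
    have hZb' := hZ1 o (!sg s)
    have hYs := hY1 s (sg s)
    have hYb := hY1 o (sg s)
    have hYb' := hY1 o (!sg s)
    have hm2 := le_max_right (Z o (sg s) : ℝ) (Z s (sg s) + 3 / 4)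
    by_cases hsg : sg o = sg s
    · obtain ⟨h7, h8⟩ := h5 hsg
      rw [if_neg hob, if_pos hso] at h8
      refine ⟨ov_of (sg s) ?_ ?_, ov_of (sg s) ?_ ?_, Or.inr ⟨sg s, ?_⟩⟩ <;> beta_reduce
      · rw [h1, h7]
        linarith
      · rw [h2, h7]
        linarith
      · rw [h3, h8]
        linarith
      · rw [h3, h4]
        linarith
      · rw [h3, h8]
        ring
    · obtain ⟨h7, h8, h9⟩ := h6 hsg
      rw [if_neg hob, if_pos hso] at h8
      refine ⟨ov_of (sg s) ?_ ?_, ov_of (sg s) ?_ ?_, Or.inl ⟨!sg s, ?_⟩⟩ <;> beta_reduce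
      · rw [h1, h7]
        linarith
      · rw [h2, h8]
        norm_num
      · rw [h3, h9]
        linarith
      · rw [h3, h4]
        linarith
      · rw [Bool.not_not, h2, h8]
        ring
  · intro s b t hb hst hts hnadj
    have htb : t ≠ b := by
      rintro rfl
      exact hnadj (X.brk_adj s t hb).2.2
    obtain ⟨h1, h2, h3⟩ := (hspec s s b hb (SimpleGraph.Reachable.refl _)).1 rfl
    obtain ⟨h4, h5, h6⟩ := (hspec t s b hb hst).2 hts
    by_cases hsg : sg t = sg s
    · obtain ⟨h7, h8⟩ := h5 hsg
      rw [if_neg htb, if_neg hnadj] at h8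
      right
      intro hov
      have := hov (sg s)
      beta_reduce at this
      rw [h3, h8] at this
      linarith
    · obtain ⟨h7, h8, h9⟩ := h6 hsg
      rw [if_neg htb, if_neg hnadj] at h8
      left
      intro hov
      have := hov (!sg s)
      beta_reduce at this
      rw [Bool.not_not, h2, h8] at this
      linarith

/-! ### Assembling the boxes -/

theorem ThickOrder.noncross' {V : Type*} {G : SimpleGraph V} {C : V → Prop} (O : ThickOrder G C)
    {a b a' b' : V} (ha : ¬ C a) (hb : ¬ C b) (ha' : ¬ C a') (hb' : ¬ C b') (haa : G.Adj a a')
    (hbb : G.Adj b b') (hab : O.q a < O.q b) (h1 : O.q b ≤ O.q a') (h2 : O.q b' ≤ O.q a) :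
    a' = b ∨ b' = a := by
  by_contra! hcon
  have h3 : O.q a' ≠ O.q b := fun h => hcon.1 (O.inj _ _ ha' hb h)
  have h4 : O.q b' ≠ O.q a := fun h => hcon.2 (O.inj _ _ hb' ha h)
  exact O.noncross a a' b b' ha ha' hb hb' haa hbb (by omega) hab (by omega)

/-- The interval of `v` in coordinate `i` is `[-e i v false, e i v true]`; recording signed extents
per direction lets the two colours be treated by one argument. -/
theorem ThinExtents.exists_extents {V : Type*} [Finite V] {G : SimpleGraph V} {C : V → Prop}
    (h : IsSaturated G C) {O : ThickOrder G C} (T : ThinExtents O) :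
    ∃ e : Fin 3 → V → Bool → ℝ, (∀ i v, 0 < e i v true + e i v false) ∧
      ∀ v w, v ≠ w → (G.Adj v w ↔ ∀ i, Ov (e i) v w) ∧ (G.Adj v w → ∃ i, Tch (e i) v w) := by
  classical
  cases nonempty_fintype V
  have hXL : ∀ a, ∃ x : ℤ, ¬ C a → (∃ d, C d ∧ G.Adj a d ∧ x = T.X.r d) ∧
      ∀ d, C d → G.Adj a d → x ≤ T.X.r d := by
    intro a
    by_cases ha : C a
    · exact ⟨0, fun h => absurd ha h⟩
    obtain ⟨x, hx, hax, -⟩ := h.exists_nonmulti ha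
    obtain ⟨d, hd, hmin⟩ := Finset.exists_min_image
      (Finset.univ.filter (fun d => C d ∧ G.Adj a d)) T.X.r ⟨x, by simp [hx, hax]⟩
    simp only [Finset.mem_filter, Finset.mem_univ, true_and] at hd hmin
    exact ⟨T.X.r d, fun _ => ⟨⟨d, hd.1, hd.2, rfl⟩, fun d' h1 h2 => hmin d' ⟨h1, h2⟩⟩⟩
  choose XL hXL using hXL
  obtain ⟨R, hR0, hR, -⟩ := exists_max_or (0 : ℤ) (fun _ : V => True) (fun v => T.X.r v + 1)
  have hXR : ∀ a, ¬ C a → XL a < R := by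
    intro a ha
    obtain ⟨⟨d, -, -, hd⟩, -⟩ := hXL a ha
    have := hR d trivial
    omega
  -- The margin `1/2` makes thick boxes nondegenerate without reaching another thick corner, since
  -- distinct corners differ by at least `1`.
  have hE : ∀ (f : V → ℝ) (a : V), ∃ m : ℝ, f a + 1 / 2 ≤ m ∧
      (∀ b, (¬ C b ∧ G.Adj a b) → f b ≤ m) ∧
      (m = f a + 1 / 2 ∨ ∃ b, (¬ C b ∧ G.Adj a b) ∧ m = f b) :=
    fun f a => exists_max_or _ _ f
  choose E hE1 hE2 hE3 using hE
  set YE := E (fun v => (O.q v : ℝ)) with hYE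
  set ZE := E (fun v => (O.N : ℝ) - O.q v) with hZE
  have hY1 : ∀ a, O.q a + 1 / 2 ≤ YE a := hE1 _
  have hZ1 : ∀ a, O.N - O.q a + 1 / 2 ≤ ZE a := hE1 _
  have hY2 : ∀ a b, (¬ C b ∧ G.Adj a b) → O.q b ≤ YE a := hE2 _
  have hZ2 : ∀ a b, (¬ C b ∧ G.Adj a b) → O.N - O.q b ≤ ZE a := hE2 _
  have hY3 : ∀ a, YE a = O.q a + 1 / 2 ∨ ∃ b, (¬ C b ∧ G.Adj a b) ∧ YE a = O.q b := hE3 _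
  have hZ3 : ∀ a, ZE a = O.N - O.q a + 1 / 2 ∨ ∃ b, (¬ C b ∧ G.Adj a b) ∧ ZE a = O.N - O.q b :=
    hE3 _
  clear_value YE ZE
  let x : V → Bool → ℝ := fun v σ => if C v then (if σ then (T.X.r v : ℝ) else -T.X.l v) else
    (if σ then (R : ℝ) else -XL v)
  let y : V → Bool → ℝ := fun v σ => if C v then T.y v σ else
    if σ = O.col v then YE v else -O.q v
  let z : V → Bool → ℝ := fun v σ => if C v then T.z v σ else
    if σ = O.col v then ZE v else -(O.N - O.q v)
  have hx1 : ∀ c, C c → x c true = T.X.r c ∧ x c false = -T.X.l c := fun c hc => by simp [x, hc]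
  have hx2 : ∀ c, ¬ C c → x c true = R ∧ x c false = -XL c := fun c hc => by simp [x, hc]
  have hy1 : ∀ c, C c → ∀ σ, y c σ = T.y c σ := fun c hc σ => by simp [y, hc]
  have hz1 : ∀ c, C c → ∀ σ, z c σ = T.z c σ := fun c hc σ => by simp [z, hc]
  have hy2 : ∀ a, ¬ C a → y a (O.col a) = YE a ∧ y a (!O.col a) = -O.q a :=
    fun a ha => by simp [y, ha]
  have hz2 : ∀ a, ¬ C a → z a (O.col a) = ZE a ∧ z a (!O.col a) = -(O.N - O.q a) :=
    fun a ha => by simp [z, ha]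
  clear_value x y z
  have hb3 : ∀ P : Bool → Prop, (∀ σ, P σ) ↔ P true ∧ P false := fun P => Bool.forall_bool'
    true
  have hovx : ∀ v w, Ov x v w ↔ 0 ≤ x v true + x w false ∧ 0 ≤ x v false + x w true :=
    fun v w => hb3 _
  let Good : V → V → Prop := fun v w => (G.Adj v w ↔ (Ov x v w ∧ Ov y v w ∧ Ov z v w)) ∧
    (G.Adj v w → Tch x v w ∨ Tch y v w ∨ Tch z v w)
  have hsymm : ∀ v w, Good v w → Good w v := by
    rintro v w ⟨h1, h2⟩
    refine ⟨?_, ?_⟩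
    · rw [G.adj_comm, h1, ov_comm (e := x), ov_comm (e := y), ov_comm (e := z)]
    · rw [G.adj_comm, tch_comm (e := x), tch_comm (e := y), tch_comm (e := z)]
      exact h2
  have hgood_of_not : ∀ v w, ¬ G.Adj v w → (¬ Ov x v w ∨ ¬ Ov y v w ∨ ¬ Ov z v w) → Good v w := by
    intro v w h1 h2
    refine ⟨⟨fun h => absurd h h1, fun h => ?_⟩, fun h => absurd h h1⟩
    tauto
  have hgood_of : ∀ v w, G.Adj v w → Ov x v w → Ov y v w → Ov z v w →
      (Tch x v w ∨ Tch y v w ∨ Tch z v w) → Good v w := by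
    intro v w h1 h2 h3 h4 h5
    exact ⟨⟨fun _ => ⟨h2, h3, h4⟩, fun _ => h1⟩, fun _ => h5⟩
  have thickthick : ∀ a b, ¬ C a → ¬ C b → O.q a < O.q b → Good a b := by
    intro a b ha hb hab
    have hab' : (O.q a : ℝ) < O.q b := by exact_mod_cast hab
    have hab1 : (O.q a : ℝ) + 1 ≤ O.q b := by exact_mod_cast hab
    have hqa : (3 : ℝ) ≤ O.q a := by exact_mod_cast O.lower a ha
    by_cases hcol : O.col a = O.col b
    swap
    · refine hgood_of_not a b (fun h => hcol (O.adj_col a b ha hb h)) (Or.inr (Or.inl fun hov => ?_))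
      have := hov (!O.col a)
      rw [Bool.not_not, Bool.eq_not_of_ne hcol, Bool.not_not] at this
      have h1 := (hy2 a ha).2
      rw [Bool.eq_not_of_ne hcol, Bool.not_not] at h1
      rw [h1, (hy2 b hb).2] at this
      linarith
    have hy2b := hy2 b hb
    have hz2b := hz2 b hb
    rw [← hcol] at hy2b hz2b
    -- Two thick boxes of one colour meet only if `a` has a neighbour at or beyond `b` and `b` one
    -- at or before `a`. Without crossings one of these extents ends exactly at the other corner,
    -- which gives both adjacency and contact.
    have hcross : O.q b ≤ YE a → O.N - O.q a ≤ ZE b →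
        (G.Adj a b ∧ (YE a = O.q b ∨ ZE b = O.N - O.q a)) := by
      intro h1 h2
      rcases hY3 a with h3 | ⟨a', ⟨ha', haa⟩, h3⟩
      · linarith
      rcases hZ3 b with h4 | ⟨b', ⟨hb', hbb⟩, h4⟩
      · linarith
      have h5 : O.q b ≤ O.q a' := by
        rw [h3] at h1
        exact_mod_cast h1
      have h6 : O.q b' ≤ O.q a := by
        rw [h4] at h2
        have : (O.q b' : ℝ) ≤ O.q a := by linarith
        exact_mod_cast this
      rcases O.noncross' ha hb ha' hb' haa hbb hab h5 h6 with rfl | rfl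
      · exact ⟨haa, Or.inl h3⟩
      · exact ⟨hbb.symm, Or.inr h4⟩
    have hYb := hY1 b
    have hZa := hZ1 a
    by_cases hadj : G.Adj a b
    · have h1 := hY2 a b ⟨hb, hadj⟩
      have h2 := hZ2 b a ⟨ha, hadj.symm⟩
      refine hgood_of a b hadj ?_ ?_ ?_ ?_
      · have h3 : (XL a : ℝ) < R := by exact_mod_cast hXR a ha
        have h4 : (XL b : ℝ) < R := by exact_mod_cast hXR b hb
        rw [hovx, (hx2 a ha).1, (hx2 a ha).2, (hx2 b hb).1, (hx2 b hb).2]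
        constructor <;> linarith
      · refine ov_of (O.col a) ?_ ?_
        · rw [(hy2 a ha).1, hy2b.2]
          linarith
        · rw [(hy2 a ha).2, hy2b.1]
          linarith
      · refine ov_of (O.col a) ?_ ?_
        · rw [(hz2 a ha).1, hz2b.2]
          linarith
        · rw [(hz2 a ha).2, hz2b.1]
          linarith
      · rcases (hcross h1 h2).2 with h3 | h3
        · refine Or.inr (Or.inl ⟨O.col a, ?_⟩)
          rw [(hy2 a ha).1, hy2b.2]
          linarith
        · refine Or.inr (Or.inr ⟨!O.col a, ?_⟩)
          rw [Bool.not_not, (hz2 a ha).2, hz2b.1]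
          linarith
    · refine hgood_of_not a b hadj ?_
      by_contra! hcon
      have h1 := hcon.2.1 (O.col a)
      have h2 := hcon.2.2 (!O.col a)
      rw [(hy2 a ha).1, hy2b.2] at h1
      rw [Bool.not_not, (hz2 a ha).2, hz2b.1] at h2
      exact hadj (hcross (by linarith) (by linarith)).1
  have thinthick : ∀ t a, C t → ¬ C a → Good t a := by
    intro t a ht ha
    obtain ⟨⟨d, hd, had, hdx⟩, hle⟩ := hXL a ha
    have hYa := hY1 a
    have hZa := hZ1 a
    have hlt := T.X.lt t
    have hRt := hR t trivial
    have hRt' : (T.X.l t : ℝ) < R := by exact_mod_cast (show T.X.l t < R by omega)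
    -- Here `d` attains the left end of `a`. For a non-neighbour `t` the boxes are therefore
    -- disjoint in the first coordinate; for a neighbour the right end of `t` is exactly `XL a`.
    have hmid : O.Mid t a → d = t ∨ T.X.r t < XL a := by
      rintro ⟨u, v, hu, hv, htu, htv, hcol, h1, h2⟩
      rcases O.between t u v a ht hu hv ha htu htv hcol h1 h2 d hd had with h3 | ⟨h3, h4⟩
      · exact Or.inl h3
      · rw [hdx]
        exact Or.inr (T.X.far_lt t d h3 h4)
    by_cases hadj : G.Adj t a
    · obtain ⟨h1, h2, h3, h4⟩ := T.meet t a ht ha hadj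
      refine hgood_of t a hadj ?_ ?_ ?_ ?_
      · have h5 : (XL a : ℝ) ≤ T.X.r t := by exact_mod_cast hle t ht hadj.symm
        rw [hovx, (hx1 t ht).1, (hx1 t ht).2, (hx2 a ha).1, (hx2 a ha).2]
        constructor <;> linarith
      · refine ov_of (O.col a) ?_ ?_
        · rw [hy1 t ht, (hy2 a ha).2]
          linarith
        · rw [hy1 t ht, (hy2 a ha).1]
          linarith
      · refine ov_of (O.col a) ?_ ?_
        · rw [hz1 t ht, (hz2 a ha).2]
          linarith
        · rw [hz1 t ht, (hz2 a ha).1]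
          linarith
      · rcases T.corner t a ht ha hadj with h5 | h5 | h5
        · refine Or.inr (Or.inl ⟨O.col a, ?_⟩)
          rw [hy1 t ht, (hy2 a ha).2]
          linarith
        · refine Or.inr (Or.inr ⟨O.col a, ?_⟩)
          rw [hz1 t ht, (hz2 a ha).2]
          linarith
        · rcases hmid h5 with rfl | h6
          · refine Or.inl ⟨true, ?_⟩
            rw [Bool.not_true, (hx1 d ht).1, (hx2 a ha).2, hdx]
            ring
          · have := hle t ht hadj.symm
            omega
    · refine hgood_of_not t a hadj ?_
      rcases T.avoid t a ht ha hadj with h5 | h5 | h5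
      · refine Or.inr (Or.inl fun hov => ?_)
        have := hov (O.col a)
        rw [hy1 t ht, (hy2 a ha).2] at this
        linarith
      · refine Or.inr (Or.inr fun hov => ?_)
        have := hov (O.col a)
        rw [hz1 t ht, (hz2 a ha).2] at this
        linarith
      · refine Or.inl fun hov => ?_
        rcases hmid h5 with rfl | h6
        · exact hadj had.symm
        · have h7 := ((hovx t a).1 hov).1
          rw [(hx1 t ht).1, (hx2 a ha).2] at h7
          have h8 : (T.X.r t : ℝ) < XL a := by exact_mod_cast h6
          linarith
  have hovxt : ∀ t t', C t → C t' → (Ov x t t' ↔ T.X.l t' ≤ T.X.r t ∧ T.X.l t ≤ T.X.r t') := by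
    intro t t' ht ht'
    rw [hovx, (hx1 t ht).1, (hx1 t ht).2, (hx1 t' ht').1, (hx1 t' ht').2]
    constructor
    · rintro ⟨h1, h2⟩
      have h1' : (T.X.l t' : ℝ) ≤ T.X.r t := by linarith
      have h2' : (T.X.l t : ℝ) ≤ T.X.r t' := by linarith
      exact ⟨by exact_mod_cast h1', by exact_mod_cast h2'⟩
    · rintro ⟨h1, h2⟩
      have h1' : (T.X.l t' : ℝ) ≤ T.X.r t := by exact_mod_cast h1
      have h2' : (T.X.l t : ℝ) ≤ T.X.r t' := by exact_mod_cast h2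
      constructor <;> linarith
  have htchx : ∀ t t', C t → C t' → (T.X.r t = T.X.l t' ∨ T.X.r t' = T.X.l t) →
      Ov x t t' ∧ Tch x t t' := by
    intro t t' ht ht' h1
    have h2 := T.X.lt t
    have h3 := T.X.lt t'
    refine ⟨(hovxt t t' ht ht').2 (by omega), ?_⟩
    rcases h1 with h1 | h1
    · refine ⟨true, ?_⟩
      rw [Bool.not_true, (hx1 t ht).1, (hx1 t' ht').2, h1]
      ring
    · refine ⟨false, ?_⟩
      rw [Bool.not_false, (hx1 t ht).2, (hx1 t' ht').1, h1]
      ring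
  have hovy : ∀ t t', C t → C t' → (Ov y t t' ↔ Ov T.y t t') := by
    intro t t' ht ht'
    simp only [Ov, hy1 t ht, hy1 t' ht']
  have hovz : ∀ t t', C t → C t' → (Ov z t t' ↔ Ov T.z t t') := by
    intro t t' ht ht'
    simp only [Ov, hz1 t ht, hz1 t' ht']
  have htchy : ∀ t t', C t → C t' → (Tch y t t' ↔ Tch T.y t t') := by
    intro t t' ht ht'
    simp only [Tch, hy1 t ht, hy1 t' ht']
  have htchz : ∀ t t', C t → C t' → (Tch z t t' ↔ Tch T.z t t') := by
    intro t t' ht ht'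
    simp only [Tch, hz1 t ht, hz1 t' ht']
  have special : ∀ s b t, T.X.Brk s b → C s → C t → t ≠ s → Good s t := by
    intro s b t hb hs ht hts
    by_cases hadj : G.Adj s t
    · by_cases htb : t = b
      · subst htb
        obtain ⟨h1, h2⟩ := T.ov_brk s t hb
        obtain ⟨h3, h4⟩ := htchx s t hs ht (T.X.brk_touch s t hb)
        exact hgood_of s t hadj h3 ((hovy s t hs ht).2 h1) ((hovz s t hs ht).2 h2) (Or.inl h4)
      · obtain ⟨h1, h2, h3⟩ := T.ov_other s b t hb ht hadj htb
        obtain ⟨h4, h5⟩ := T.X.brk_overlap s b t hb ⟨hs, ht, hadj⟩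
        refine hgood_of s t hadj ((hovxt s t hs ht).2 ⟨h5, h4⟩) ((hovy s t hs ht).2 h1)
          ((hovz s t hs ht).2 h2) (Or.inr ?_)
        rwa [htchy s t hs ht, htchz s t hs ht]
    · refine hgood_of_not s t hadj ?_
      by_cases hreach : (graphOn G C).Reachable s t
      · rw [hovy s t hs ht, hovz s t hs ht]
        exact Or.inr (T.apart s b t hb hreach hts hadj)
      · left
        rw [hovxt s t hs ht]
        have := T.X.brk_apart s b t hb ht hreach
        omega
  have thinthin : ∀ t t', C t → C t' → t ≠ t' → Good t t' := by
    intro t t' ht ht' hne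
    by_cases h1 : ∃ b, T.X.Brk t b
    · obtain ⟨b, hb⟩ := h1
      exact special t b t' hb ht ht' hne.symm
    by_cases h2 : ∃ b, T.X.Brk t' b
    · obtain ⟨b, hb⟩ := h2
      exact hsymm _ _ (special t' b t hb ht' ht hne)
    push Not at h1 h2
    by_cases hadj : G.Adj t t'
    · obtain ⟨h3, h4⟩ := htchx t t' ht ht' (T.X.touch t t' ht ht' h1 h2 hadj)
      obtain ⟨h5, h6⟩ := T.ov_plain t t' ht ht' hadj h1 h2
      exact hgood_of t t' hadj h3 ((hovy t t' ht ht').2 h5) ((hovz t t' ht ht').2 h6) (Or.inl h4)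
    · refine hgood_of_not t t' hadj (Or.inl ?_)
      rw [hovxt t t' ht ht']
      have := T.X.apart t t' ht ht' hne h1 h2 hadj
      omega
  have all : ∀ v w, v ≠ w → Good v w := by
    intro v w hne
    by_cases hv : C v <;> by_cases hw : C w
    · exact thinthin v w hv hw hne
    · exact thinthick v w hv hw
    · exact hsymm _ _ (thinthick w v hw hv)
    · rcases lt_or_gt_of_ne (fun h => hne (O.inj v w hv hw h)) with h1 | h1
      · exact thickthick v w hv hw h1
      · exact hsymm _ _ (thickthick w v hw hv h1)
  have hposb : ∀ (f : Bool → ℝ) (σ : Bool), 0 < f σ + f (!σ) → 0 < f true + f false := by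
    intro f σ hf
    cases σ
    · rw [add_comm]
      exact hf
    · exact hf
  refine ⟨![x, y, z], fun i v => ?_, fun v w hne => ⟨?_, fun hadj => ?_⟩⟩
  · by_cases hv : C v
    · fin_cases i
      · have : (T.X.l v : ℝ) < T.X.r v := by exact_mod_cast T.X.lt v
        simp only [Fin.zero_eta, Matrix.cons_val_zero, (hx1 v hv).1, (hx1 v hv).2]
        linarith
      · simpa [hy1 v hv] using T.pos_y v true
      · simpa [hz1 v hv] using T.pos_z v true
    · fin_cases i
      · have : (XL v : ℝ) < R := by exact_mod_cast hXR v hv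
        simp only [Fin.zero_eta, Matrix.cons_val_zero, (hx2 v hv).1, (hx2 v hv).2]
        linarith
      · refine hposb (y v) (O.col v) ?_
        rw [(hy2 v hv).1, (hy2 v hv).2]
        linarith [hY1 v]
      · refine hposb (z v) (O.col v) ?_
        rw [(hz2 v hv).1, (hz2 v hv).2]
        linarith [hZ1 v]
  · rw [(all v w hne).1]
    simp [Fin.forall_fin_succ]
  · rcases (all v w hne).2 hadj with h1 | h1 | h1
    · exact ⟨0, h1⟩
    · exact ⟨1, h1⟩
    · exact ⟨2, h1⟩

theorem isSaturated_of_card_le {V : Type*} [Fintype V] {G : SimpleGraph V} [DecidableRel G.Adj]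
    (hG : ∀ v, (Finset.univ.filter (G.Adj v)).card ≤ 3) : ∃ C, IsSaturated G C := by
  classical
  obtain ⟨C, h1, h2⟩ := exists_saturated_set G hG
  refine ⟨C, ⟨?_, h1, h2⟩⟩
  intro u a b c ha hb hc hab hac hbc d hd
  by_contra! hcon
  have hle := Finset.card_le_card (s := {d, a, b, c}) (t := Finset.univ.filter (G.Adj u)) (by
    intro x hx
    simp only [Finset.mem_insert, Finset.mem_singleton] at hx
    rcases hx with rfl | rfl | rfl | rfl <;> simp [*])
  rw [Finset.card_insert_of_notMem (by simp [hcon]), Finset.card_eq_three.2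
    ⟨a, b, c, hab, hac, hbc, rfl⟩] at hle
  have := hG u
  omega

theorem theorem1 {V : Type*} [Fintype V] (G : SimpleGraph V) [DecidableRel G.Adj]
    (hG : G.maxDegree ≤ 3) :
    (∃ B : V → Set (Fin 3 → ℝ), IsBoxRepresentation G B ∧
      (∀ v, (interior (B v)).Nonempty) ∧
      ∀ v w, v ≠ w → B v ∩ B w ⊆ frontier (B v) ∩ frontier (B w)) ∧
    boxicity G ≤ 3 := by
  suffices hB : ∃ B : V → Set (Fin 3 → ℝ), IsBoxRepresentation G B ∧
      (∀ v, (interior (B v)).Nonempty) ∧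
      ∀ v w, v ≠ w → B v ∩ B w ⊆ frontier (B v) ∩ frontier (B w) by
    refine ⟨hB, ?_⟩
    obtain ⟨B, hB, -⟩ := hB
    exact iInf₂_le 3 ⟨B, hB⟩
  obtain ⟨C, hC⟩ := isSaturated_of_card_le (G := G) (fun v => by
    have h1 := G.degree_le_maxDegree v
    rw [← SimpleGraph.card_neighborFinset_eq_degree, SimpleGraph.neighborFinset_eq_filter] at h1
    exact h1.trans hG)
  obtain ⟨O⟩ := hC.nonempty_thickOrder
  obtain ⟨T⟩ := hC.nonempty_thinExtents O
  obtain ⟨e, hpos, he⟩ := T.exists_extents hC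
  let B : V → Set (Fin 3 → ℝ) := fun v =>
    Set.pi Set.univ (fun i => Set.Icc (-e i v false) (e i v true))
  have hint : ∀ v, interior (B v) =
      Set.pi Set.univ (fun i => Set.Ioo (-e i v false) (e i v true)) := by
    intro v
    simp only [B, interior_pi_set Set.finite_univ, interior_Icc]
  have hclosed : ∀ v, IsClosed (B v) := fun v => isClosed_set_pi fun _ _ => isClosed_Icc
  have hov : ∀ v w p, p ∈ B v → p ∈ B w → ∀ i, Ov (e i) v w := by
    intro v w p hv hw i
    have h1 := hv i trivial
    have h2 := hw i trivial
    exact ov_of true (by simp only [Bool.not_true]; linarith [h1.2, h2.1])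
      (by simp only [Bool.not_true]; linarith [h1.1, h2.2])
  -- Contact in a single coordinate puts every common point on opposite faces of the two boxes.
  have hfr : ∀ v w p i, p ∈ B v → p ∈ B w → Tch (e i) v w → p ∈ frontier (B v) := by
    rintro v w p i hv hw ⟨σ, hσ⟩
    rw [(hclosed v).frontier_eq, hint]
    refine ⟨hv, fun hp => ?_⟩
    have h1 := hp i trivial
    have h2 := hw i trivial
    cases σ
    · simp only [Bool.not_false] at hσ
      linarith [h1.1, h2.2]
    · simp only [Bool.not_true] at hσ
      linarith [h1.2, h2.1]
  refine ⟨B, ⟨fun v => ⟨fun i => -e i v false, fun i => e i v true, fun i => ?_, rfl⟩,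
    fun v w => ?_⟩, fun v => ?_, fun v w hne p hp => ?_⟩
  · linarith [hpos i v]
  · constructor
    · intro hadj
      have h1 := (he v w hadj.ne).1.1 hadj
      refine ⟨hadj.ne, fun i => max (-e i v false) (-e i w false), fun i _ => ?_, fun i _ => ?_⟩
      · have h2 := h1 i true
        have h3 := h1 i false
        simp only [Bool.not_true, Bool.not_false] at h2 h3
        exact ⟨le_max_left _ _, max_le (by linarith [hpos i v]) (by linarith)⟩
      · have h2 := h1 i true
        have h3 := h1 i false
        simp only [Bool.not_true, Bool.not_false] at h2 h3
        exact ⟨le_max_right _ _, max_le (by linarith) (by linarith [hpos i w])⟩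
    · rintro ⟨hne, p, hv, hw⟩
      exact (he v w hne).1.2 (hov v w p hv hw)
  · rw [hint]
    refine ⟨fun i => (-e i v false + e i v true) / 2, fun i _ => ?_⟩
    constructor <;> linarith [hpos i v]
  · have hadj := (he v w hne).1.2 (hov v w p hp.1 hp.2)
    obtain ⟨i, hi⟩ := (he v w hne).2 hadj
    exact ⟨hfr v w p i hp.1 hp.2 hi, hfr w v p i hp.2 hp.1 (tch_comm.1 hi)⟩
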